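/- **Setting.** Let $\mathcal H,\mathcal H'$ be separable complex Hilbert spaces, $\tau c(\mathcal H)$ the trace-class operators ($\|A\|_1=\mathrm{tr}|A|<\infty$), and consider linear maps $\Lambda:\tau c(\mathcal H)\to\tau c(\mathcal H')$. Such a map is completely positive if $(\Lambda\otimes\mathbf I)(A)\ge 0$ for every trace-class $A\ge0$ on $\mathcal H\otimes\mathcal K$ and every ancilla $\mathcal K$ (a separable Hilbert space), and $\|\Lambda\|_{cb}=\sup\{\|(\Lambda\otimes\mathbf I)(X)\|_1:\|X\|_1=1\}$ over all ancillas. Let $\Theta\subset\mathbb R^m$ be open and $\mathcal L=\{\Lambda_\theta\}_{\theta\in\Theta}$ a family of completely positive trace-preserving maps $\tau c(\mathcal H)\to\tau c(\mathcal H')$. *Regularity of the model (CM.1).* $\partial_i\Lambda_\theta$ and $\partial_i\partial_j\Lambda_\theta$ exist for all $\theta\in\Theta$, are locally uniformly continuous in $\theta$, and $\|\partial_i\Lambda_\theta\|_{cb},\|\partial_i\partial_j\Lambda_\theta\|_{cb}\le a_1/2<\infty$ on $\Theta$; derivatives and continuity are understood in $\|\cdot\|_{cb}$. *Estimators.* An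 estimator $\mathcal E_n$ with $n\ge1$ uses of the unknown operation consists of an ancilla $\mathcal K$, a density operator $\rho^n$ on $\mathcal H\otimes\mathcal K$, completely positive trace-preserving maps $\Xi^n_1,\dots,\Xi^n_{n-1}$ from $\tau c(\mathcal H'\otimes\mathcal K)$ to $\tau c(\mathcal H\otimes\mathcal K)$, a POVM $M^n$ on $\mathcal H'\otimes\mathcal K$ with outcomes in some $\mathbb R^{l_n}$, and a measurable map $T_n:\mathbb R^{l_n}\to\mathbb R^m$. The data $\omega_n$ have distribution $$P^{\mathcal E_n}_\theta(\Delta)=\mathrm{tr}\,\big[(\Lambda_\theta\otimes\mathbf I)\circ\Xi^n_{n-1}\circ(\Lambda_\theta\otimes\mathbf I)\circ\cdots\circ\Xi^n_1\circ(\Lambda_\theta\otimes\mathbf I)\big](\rho^n)\,M^n(\Delta).$$ Write $\mathrm E_\theta$ for the expectation under $P^{\mathcal E_n}_\theta$ and $(\mathrm{MSE}_\theta[\mathcal E_n])_{ij}=\mathrm E_\theta[(T_n^i-\theta^i)(T_n^j-\theta^j)]$. A sequence $\{\mathcal E_n\}_{n\ge1}$ is *admissible* if 1. (asymptotic unbiasedness)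 for all $\theta\in\Theta$: $\lim_n\mathrm E_\theta[T_n]=\theta$, and the partial derivatives $\partial_j\mathrm E_\theta[T_n^i]$ exist with $\lim_n\partial_j\mathrm E_\theta[T_n^i]=\delta^i_j$; 2. (CE) there are $a_2>0$ and completely positive maps $\square_{i,\theta}$ ($1\le i\le m$, $\theta\in\Theta$) such that $\square_{i,\theta}-\partial_i\Lambda_{\theta_0}$ is completely positive whenever $\theta,\theta_0\in\Theta$, $\|\theta_0-\theta\|<a_2$, and for every $n\ge1$ there is $a_{4,n}<\infty$ with, for all $\theta\in\Theta$ and all $i$, $$\int\|T_n(\omega)-\theta\|\,\mathrm{tr}\,\varpi^n_{i,\theta}M^n(d\omega)\le n a_1a_{4,n},\qquad \int\|T_n(\omega)-\theta\|^2\,P^{\mathcal E_n}_\theta(d\omega)\le n\,a_{4,n}^2,$$ where $\varpi^n_{i,\theta}$ is the sum over $\kappa=1,\dots,n$ of the final states obtained when the $\kappa$-th use of $\Lambda_\theta$ is replaced by $\square_{i,\theta}$. For $\theta\in\Theta$ and a real symmetric positive semidefinite $m\times m$ matrix $G_\theta\neq0$ let $$C_\theta(G_\theta,\mathcal L)=\inf\Big\{\limsup_{n\to\infty}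 n\,\mathrm{Tr}\,G_\theta\,\mathrm{MSE}_\theta[\mathcal E_n]\;:\;\{\mathcal E_n\}\text{ admissible}\Big\}\in[0,\infty].$$ **Theorem.** Assume (CM.1), and that there is $\varepsilon>0$ such that $\Lambda_\theta+\sum_{i=1}^m u^i\,\partial_i\Lambda_\theta$ is completely positive for all $u\in\mathbb R^m$ with $\|u\|<\varepsilon$ and all $\theta\in\Theta$. Then, for every $\theta\in\Theta$ and every such $G_\theta$, $C_\theta(G_\theta,\mathcal L)\neq0$. In particular no admissible sequence satisfies $\mathrm{Tr}\,G_\theta\,\mathrm{MSE}_\theta[\mathcal E_n]=O(1/n^2)$ (no Heisenberg scaling). -/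

import Mathlib

open scoped ENNReal NNReal InnerProductSpace Topology
open Filter MeasureTheory

noncomputable section

namespace QuantumEstimation

universe u v

/-! ### Trace-class operators -/

section TraceClass

variable (E : Type u) [NormedAddCommGroup E] [InnerProductSpace ℂ E] [CompleteSpace E]

/-- The index set of a fixed complete orthonormal system of `E`. -/
def basisIndex : Set E := (exists_hilbertBasis ℂ E).choose

/-- A fixed complete orthonormal system of `E`. -/
def basis : HilbertBasis (basisIndex E) ℂ E := (exists_hilbertBasis ℂ E).choose_spec.choose

variable {E}

/-- The trace `∑ ⟨e_i, A e_i⟩ ∈ [0, ∞]` of a positive operator. -/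
def posTrace (A : E →L[ℂ] E) : ℝ≥0∞ :=
  ∑' i, ENNReal.ofReal (RCLike.re ⟪basis E i, A (basis E i)⟫_ℂ)

/-- The trace norm `‖A‖₁ = tr |A|`, with values in `[0, ∞]`. -/
def traceNorm (A : E →L[ℂ] E) : ℝ≥0∞ := posTrace (CFC.abs A)

/-- The trace `∑ ⟨e_i, A e_i⟩` (an absolutely convergent sum for trace-class `A`). -/
def trace (A : E →L[ℂ] E) : ℂ := ∑' i, ⟪basis E i, A (basis E i)⟫_ℂ

theorem norm_abs_apply (A : E →L[ℂ] E) (v : E) : ‖CFC.abs A v‖ = ‖A v‖ := by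
  have h : CFC.abs A * CFC.abs A = star A * A := CFC.abs_mul_abs A
  have hs : star (CFC.abs A) = CFC.abs A := (IsSelfAdjoint.of_nonneg (CFC.abs_nonneg A)).star_eq
  have h1 : ⟪CFC.abs A v, CFC.abs A v⟫_ℂ = ⟪A v, A v⟫_ℂ := by
    rw [← ContinuousLinearMap.adjoint_inner_right, ← ContinuousLinearMap.adjoint_inner_right A,
      ← ContinuousLinearMap.star_eq_adjoint, ← ContinuousLinearMap.star_eq_adjoint, hs]
    exact congrArg (fun B : E →L[ℂ] E => ⟪v, B v⟫_ℂ) h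
  have h2 : ‖CFC.abs A v‖ ^ 2 = ‖A v‖ ^ 2 := by
    rw [← inner_self_eq_norm_sq (𝕜 := ℂ), ← inner_self_eq_norm_sq (𝕜 := ℂ), h1]
  exact (sq_eq_sq₀ (norm_nonneg _) (norm_nonneg _)).1 h2

/-- Polar decomposition. -/
theorem exists_polar (A : E →L[ℂ] E) :
    ∃ U : E →L[ℂ] E, (∀ v, ‖U v‖ ≤ ‖v‖) ∧ A = U * CFC.abs A ∧ CFC.abs A = star U * A := by
  classical
  set S : E →L[ℂ] E := CFC.abs A with hS
  let V : Submodule ℂ E := (LinearMap.range (S : E →ₗ[ℂ] E)).topologicalClosure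
  have : CompleteSpace V :=
    (Submodule.isClosed_topologicalClosure _).completeSpace_coe
  let e : E →ₗ[ℂ] V := (S : E →ₗ[ℂ] E).codRestrict V
    (fun v => Submodule.le_topologicalClosure _ (LinearMap.mem_range_self _ v))
  have hdense : DenseRange e := by
    intro x
    rw [Topology.IsInducing.subtypeVal.closure_eq_preimage_closure_image]
    change (x : E) ∈ closure (Subtype.val '' Set.range e)
    have himg : (Subtype.val '' Set.range e : Set E) =
        (LinearMap.range (S : E →ₗ[ℂ] E) : Set E) := by
      ext z
      constructor
      · rintro ⟨_, ⟨v, rfl⟩, rfl⟩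
        exact ⟨v, rfl⟩
      · rintro ⟨v, rfl⟩
        exact ⟨e v, ⟨v, rfl⟩, rfl⟩
    rw [himg]
    exact x.2
  have hbd : ∀ v, ‖(A : E →ₗ[ℂ] E) v‖ ≤ 1 * ‖e v‖ := by
    intro v
    rw [one_mul]
    exact (norm_abs_apply A v).ge
  let U₀ : V →L[ℂ] E := (A : E →ₗ[ℂ] E).extendOfNorm e
  let U : E →L[ℂ] E := U₀ ∘L V.orthogonalProjectionOnto
  have hU : ∀ v, ‖U v‖ ≤ ‖v‖ := by
    intro v
    have h1 : ‖U₀ (V.orthogonalProjectionOnto v)‖ ≤ 1 * ‖V.orthogonalProjectionOnto v‖ :=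
      LinearMap.norm_extendOfNorm_apply_le hdense 1 hbd _
    rw [one_mul] at h1
    exact h1.trans (V.norm_orthogonalProjectionOnto_apply_le v)
  have hUS : ∀ v, U (S v) = A v := by
    intro v
    have h1 : V.orthogonalProjectionOnto (S v) = e v :=
      Submodule.orthogonalProjectionOnto_mem_subspace_eq_self (e v)
    show U₀ (V.orthogonalProjectionOnto (S v)) = A v
    rw [h1]
    exact LinearMap.extendOfNorm_eq hdense ⟨1, hbd⟩ v
  refine ⟨U, hU, ?_, ?_⟩
  · ext v
    exact (hUS v).symm
  · ext v
    have hadj : ∀ w, ‖star U w‖ ≤ ‖w‖ := by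
      intro w
      have hn : ‖star U‖ ≤ 1 := by
        rw [norm_star]
        exact U.opNorm_le_bound zero_le_one (fun v => by simpa using hU v)
      simpa using (star U).le_of_opNorm_le hn w
    have hAv : ‖A v‖ = ‖S v‖ := (norm_abs_apply A v).symm
    have hin : RCLike.re ⟪star U (A v), S v⟫_ℂ = ‖A v‖ ^ 2 := by
      rw [ContinuousLinearMap.star_eq_adjoint, ContinuousLinearMap.adjoint_inner_left, hUS,
        inner_self_eq_norm_sq]
    have h0 : ‖star U (A v) - S v‖ ^ 2 ≤ 0 := by
      rw [@norm_sub_sq ℂ, hin]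
      have := hadj (A v)
      have h2 : ‖star U (A v)‖ ^ 2 ≤ ‖A v‖ ^ 2 := by gcongr
      rw [← hAv]
      linarith
    have h3 : ‖star U (A v) - S v‖ = 0 := by
      have := sq_nonneg ‖star U (A v) - S v‖
      exact pow_eq_zero_iff (two_ne_zero) |>.1 (le_antisymm h0 this)
    exact (sub_eq_zero.1 (norm_eq_zero.1 h3)).symm

/-- `A = ∑ |x_i⟩⟨y_i|` with `∑ ‖x_i‖ ‖y_i‖ < ∞`. -/
def HasNuclearSum {ι : Type*} {E F : Type*} [NormedAddCommGroup E] [InnerProductSpace ℂ E]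
    [NormedAddCommGroup F] [InnerProductSpace ℂ F]
    (A : F →L[ℂ] E) (x : ι → E) (y : ι → F) : Prop :=
  ∑' i, ‖x i‖ₑ * ‖y i‖ₑ < ∞ ∧ ∀ v, HasSum (fun i => ⟪y i, v⟫_ℂ • x i) (A v)

theorem exists_hasNuclearSum {A : E →L[ℂ] E} (hA : traceNorm A < ∞) :
    ∃ x y : basisIndex E → E, HasNuclearSum A x y := by
  obtain ⟨U, hU, hA1, -⟩ := exists_polar A
  have hS : 0 ≤ CFC.abs A := CFC.abs_nonneg A
  set R : E →L[ℂ] E := CFC.sqrt (CFC.abs A) with hR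
  have hRR : R * R = CFC.abs A := CFC.sqrt_mul_sqrt_self _ hS
  have hRs : star R = R := (IsSelfAdjoint.of_nonneg (CFC.sqrt_nonneg _)).star_eq
  have hRin : ∀ v w, ⟪R v, w⟫_ℂ = ⟪v, R w⟫_ℂ := by
    intro v w
    rw [← ContinuousLinearMap.adjoint_inner_right, ← ContinuousLinearMap.star_eq_adjoint, hRs]
  refine ⟨fun i => U (R (basis E i)), fun i => R (basis E i), ?_, ?_⟩
  · refine lt_of_le_of_lt (ENNReal.tsum_le_tsum fun i => ?_) hA
    have h1 : RCLike.re ⟪basis E i, CFC.abs A (basis E i)⟫_ℂ = ‖R (basis E i)‖ ^ 2 := by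
      rw [← hRR]
      change RCLike.re ⟪basis E i, R (R (basis E i))⟫_ℂ = _
      rw [← hRin, inner_self_eq_norm_sq]
    rw [h1, ← ofReal_norm, ← ofReal_norm,
      ← ENNReal.ofReal_mul (norm_nonneg _)]
    apply ENNReal.ofReal_le_ofReal
    rw [sq]
    gcongr
    exact hU _
  · intro v
    have h1 := ((basis E).hasSum_repr (R v)).mapL (U * R)
    have h2 : A v = (U * R) (R v) := by
      conv_lhs => rw [hA1, ← hRR]
      rfl
    rw [h2]
    convert h1 using 2 with i
    rw [map_smul, HilbertBasis.repr_apply_apply, hRin]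
    rfl

/-- Bessel and Cauchy-Schwarz. -/
theorem tsum_enorm_inner_mul_le (x y : E) :
    ∑' i, ‖⟪x, basis E i⟫_ℂ‖ₑ * ‖⟪basis E i, y⟫_ℂ‖ₑ ≤ ‖x‖ₑ * ‖y‖ₑ := by
  rw [ENNReal.tsum_eq_iSup_sum]
  refine iSup_le fun s => ?_
  simp only [← ofReal_norm, ← ENNReal.ofReal_mul (norm_nonneg _)]
  rw [← ENNReal.ofReal_sum_of_nonneg (fun i _ => by positivity)]
  apply ENNReal.ofReal_le_ofReal
  have hx := (basis E).orthonormal.sum_inner_products_le (s := s) x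
  have hy := (basis E).orthonormal.sum_inner_products_le (s := s) y
  have hcs := Finset.sum_mul_sq_le_sq_mul_sq s (fun i => ‖⟪x, basis E i⟫_ℂ‖)
    (fun i => ‖⟪basis E i, y⟫_ℂ‖)
  simp only [norm_inner_symm x] at hcs ⊢
  refine abs_le_of_sq_le_sq' ?_ (by positivity) |>.2
  calc _ ≤ _ := hcs
    _ ≤ ‖x‖ ^ 2 * ‖y‖ ^ 2 := by gcongr
    _ = _ := by ring

theorem traceNorm_lt_top {ι : Type*} {A : E →L[ℂ] E} {x y : ι → E} (h : HasNuclearSum A x y) :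
    traceNorm A < ∞ := by
  obtain ⟨U, hU, -, hA⟩ := exists_polar A
  have hadj : ∀ w, ‖star U w‖ₑ ≤ ‖w‖ₑ := by
    intro w
    have hn : ‖star U‖ ≤ 1 := by
      rw [norm_star]
      exact U.opNorm_le_bound zero_le_one (fun v => by simpa using hU v)
    simpa [enorm_le_iff_norm_le] using (star U).le_of_opNorm_le hn w
  refine lt_of_le_of_lt ?_ h.1
  calc traceNorm A
      ≤ ∑' j, ∑' i, ‖⟪y i, basis E j⟫_ℂ‖ₑ * ‖⟪basis E j, star U (x i)⟫_ℂ‖ₑ := by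
        refine ENNReal.tsum_le_tsum fun j => ?_
        have h1 : HasSum (fun i => ⟪y i, basis E j⟫_ℂ * ⟪basis E j, star U (x i)⟫_ℂ)
            ⟪basis E j, CFC.abs A (basis E j)⟫_ℂ := by
          have h2 := (h.2 (basis E j)).mapL (innerSL ℂ (basis E j) ∘L star U)
          rw [hA]
          simpa using h2
        calc ENNReal.ofReal (RCLike.re ⟪basis E j, CFC.abs A (basis E j)⟫_ℂ)
            ≤ ‖⟪basis E j, CFC.abs A (basis E j)⟫_ℂ‖ₑ := by
              rw [← ofReal_norm]
              exact ENNReal.ofReal_le_ofReal (RCLike.re_le_norm _)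
          _ ≤ ∑' i, ‖⟪y i, basis E j⟫_ℂ * ⟪basis E j, star U (x i)⟫_ℂ‖ₑ := by
              rw [← h1.tsum_eq]
              exact enorm_tsum_le_tsum_enorm
          _ = _ := by simp only [enorm_mul]
    _ = ∑' i, ∑' j, ‖⟪y i, basis E j⟫_ℂ‖ₑ * ‖⟪basis E j, star U (x i)⟫_ℂ‖ₑ :=
        ENNReal.tsum_comm
    _ ≤ ∑' i, ‖x i‖ₑ * ‖y i‖ₑ := by
        refine ENNReal.tsum_le_tsum fun i => (tsum_enorm_inner_mul_le _ _).trans ?_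
        rw [mul_comm]
        gcongr
        exact hadj _

variable (E) in
/-- The space `τc(E)` of trace-class operators: the bounded `A` with `‖A‖₁ = tr |A| < ∞`. -/
def traceClass : Submodule ℂ (E →L[ℂ] E) where
  carrier := {A | traceNorm A < ∞}
  zero_mem' := by
    refine traceNorm_lt_top (ι := PEmpty.{1}) (x := PEmpty.elim) (y := PEmpty.elim) ⟨by simp, ?_⟩
    intro v
    simp
  add_mem' := by
    intro A B hA hB
    obtain ⟨x, y, h⟩ := exists_hasNuclearSum hA
    obtain ⟨x', y', h'⟩ := exists_hasNuclearSum hB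
    refine traceNorm_lt_top (x := Sum.elim x x') (y := Sum.elim y y') ⟨?_, fun v => ?_⟩
    · rw [ENNReal.summable.tsum_sum ENNReal.summable]
      simpa using ⟨h.1, h'.1⟩
    · exact (h.2 v).sum (h'.2 v)
  smul_mem' := by
    intro c A hA
    obtain ⟨x, y, h⟩ := exists_hasNuclearSum hA
    refine traceNorm_lt_top (x := fun i => c • x i) (y := y) ⟨?_, fun v => ?_⟩
    · simp only [enorm_smul, mul_assoc, ENNReal.tsum_mul_left]
      exact ENNReal.mul_lt_top (by simp) h.1
    · simpa [smul_comm c] using (h.2 v).const_smul c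

theorem comp_comp_mem_traceClass {F : Type v} [NormedAddCommGroup F] [InnerProductSpace ℂ F]
    [CompleteSpace F] (L : E →L[ℂ] F) (A : traceClass E) (W : F →L[ℂ] E) :
    L ∘L (A : E →L[ℂ] E) ∘L W ∈ traceClass F := by
  obtain ⟨x, y, h⟩ := exists_hasNuclearSum A.2
  refine traceNorm_lt_top (x := fun i => L (x i))
    (y := fun i => ContinuousLinearMap.adjoint W (y i)) ⟨?_, fun v => ?_⟩
  · calc _ ≤ ∑' i, ‖L‖ₑ * ‖ContinuousLinearMap.adjoint W‖ₑ * (‖x i‖ₑ * ‖y i‖ₑ) := by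
          refine ENNReal.tsum_le_tsum fun i => ?_
          rw [mul_mul_mul_comm]
          gcongr
          · exact L.le_opENorm _
          · exact (ContinuousLinearMap.adjoint W).le_opENorm _
      _ < ∞ := by
          rw [ENNReal.tsum_mul_left]
          exact ENNReal.mul_lt_top (ENNReal.mul_lt_top (by simp) (by simp)) h.1
  · simpa [ContinuousLinearMap.adjoint_inner_left] using (h.2 (W v)).mapL L

end TraceClass

/-! ### Composite systems and completely positive maps -/

/-- The composite system `H ⊗ K`, where `K = ℓ²(κ)` and `H ⊗ ℓ²(κ)` is `⨁_κ H = ℓ²(κ; H)`, the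
vector `φ ⊗ e_k` being `φ` placed at the coordinate `k`. -/
abbrev WithAncilla (H : Type u) [NormedAddCommGroup H] (κ : Type) : Type u :=
  lp (fun _ : κ => H) 2

variable {H : Type u} [NormedAddCommGroup H] [InnerProductSpace ℂ H] [CompleteSpace H]
variable {H' : Type v} [NormedAddCommGroup H'] [InnerProductSpace ℂ H'] [CompleteSpace H']

open Classical in
/-- The `(k, l)` block `a : H → H` of an operator `A` on `H ⊗ K`, that is,
`⟨φ, a ψ⟩ = ⟨φ ⊗ e_k, A (ψ ⊗ e_l)⟩`, so that `A = ∑ A_kl ⊗ |e_k⟩⟨e_l|`. -/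
def block {κ : Type} (A : traceClass (WithAncilla H κ)) (k l : κ) : traceClass H :=
  ⟨lp.evalCLM ℂ (fun _ : κ => H) 2 k ∘L (A : WithAncilla H κ →L[ℂ] WithAncilla H κ) ∘L
    lp.singleContinuousLinearMap ℂ (fun _ : κ => H) 2 l, comp_comp_mem_traceClass _ A _⟩

variable (H H') in
/-- Linear maps from trace-class operators on `H` to trace-class operators on `H'`. -/
abbrev Superoperator : Type (max u v) := traceClass H →ₗ[ℂ] traceClass H'

/-- `B = (Λ ⊗ I)(A)`: the blocks of `B` are the images under `Λ` of the blocks of `A`. -/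
def IsAmpliation (Λ : Superoperator H H') {κ : Type} (A : traceClass (WithAncilla H κ))
    (B : traceClass (WithAncilla H' κ)) : Prop :=
  ∀ k l, block B k l = Λ (block A k l)

open Classical in
/-- `(Λ ⊗ I)(A)`. It exists and is unique if `Λ` is completely positive or completely bounded. -/
def ampliation (Λ : Superoperator H H') {κ : Type} (A : traceClass (WithAncilla H κ)) :
    traceClass (WithAncilla H' κ) :=
  if h : ∃ B, IsAmpliation Λ A B then h.choose else 0

/-- `Λ` is completely positive: `A ≥ 0` implies `(Λ ⊗ I)(A) ≥ 0`, for every ancilla `K`. -/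
def IsCompletelyPositive (Λ : Superoperator H H') : Prop :=
  ∀ (κ : Type) [Countable κ] (A : traceClass (WithAncilla H κ))
    (B : traceClass (WithAncilla H' κ)), IsAmpliation Λ A B →
      (A : WithAncilla H κ →L[ℂ] WithAncilla H κ).IsPositive →
      (B : WithAncilla H' κ →L[ℂ] WithAncilla H' κ).IsPositive

/-- Completely positive and trace-preserving maps, i.e. quantum operations. -/
def IsCPTP (Λ : Superoperator H H') : Prop :=
  IsCompletelyPositive Λ ∧
    ∀ A : traceClass H, trace (Λ A : H' →L[ℂ] H') = trace (A : H →L[ℂ] H)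

/-- `‖Λ‖_cb = sup {‖(Λ ⊗ I)(X)‖₁ : ‖X‖₁ = 1}` over all ancillas, with values in `[0, ∞]`; the
infimum over the at most one `B = (Λ ⊗ I)(X)` is `∞` when `(Λ ⊗ I)(X)` does not exist. -/
def cbNorm (Λ : Superoperator H H') : ℝ≥0∞ :=
  ⨆ (κ : Type) (_ : Countable κ) (X : traceClass (WithAncilla H κ))
    (_ : traceNorm (X : WithAncilla H κ →L[ℂ] WithAncilla H κ) = 1),
    ⨅ (B : traceClass (WithAncilla H' κ)) (_ : IsAmpliation Λ X B),
      traceNorm (B : WithAncilla H' κ →L[ℂ] WithAncilla H' κ)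

/-- Density operators. -/
def IsDensity {E : Type u} [NormedAddCommGroup E] [InnerProductSpace ℂ E] [CompleteSpace E]
    (ρ : traceClass E) : Prop :=
  (ρ : E →L[ℂ] E).IsPositive ∧ trace (ρ : E →L[ℂ] E) = 1

/-! ### Measurements -/

/-- A positive operator valued measure on `Ω`, `σ`-additive in the weak operator topology. -/
structure POVM (Ω : Type*) [MeasurableSpace Ω] (E : Type*) [NormedAddCommGroup E]
    [InnerProductSpace ℂ E] where
  /-- The operator `M(Δ)`. -/
  op : Set Ω → E →L[ℂ] E
  isPositive : ∀ Δ, MeasurableSet Δ → (op Δ).IsPositive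
  op_univ : op Set.univ = 1
  hasSum_iUnion : ∀ Δ : ℕ → Set Ω, (∀ k, MeasurableSet (Δ k)) → Pairwise (Function.onFun Disjoint Δ) →
    ∀ x y, HasSum (fun k => ⟪x, op (Δ k) y⟫_ℂ) ⟪x, op (⋃ k, Δ k) y⟫_ℂ

open Classical in
/-- The measure `Δ ↦ tr (ρ M(Δ))`, which exists for every positive trace-class `ρ` (for a density
operator it is the distribution of the outcome of the measurement `M` in the state `ρ`). -/
def outcomeMeasure {Ω : Type*} [MeasurableSpace Ω] {E : Type*} [NormedAddCommGroup E]
    [InnerProductSpace ℂ E] [CompleteSpace E] (ρ : traceClass E) (M : POVM Ω E) : Measure Ω :=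
  if h : ∃ μ : Measure Ω, ∀ Δ, MeasurableSet Δ →
      μ Δ = ENNReal.ofReal (trace ((ρ : E →L[ℂ] E) ∘L M.op Δ)).re
  then h.choose else 0

/-! ### Estimation of quantum operations -/

/-- The parameter space `ℝ^m` with its Euclidean norm. -/
abbrev Param (m : ℕ) : Type := EuclideanSpace ℝ (Fin m)

variable (H H') in
/-- An estimator: an ancilla `K = ℓ²(κ)`, an input state `ρ` on `H ⊗ K`, quantum operations `Ξ`
from `H' ⊗ K` to `H ⊗ K` applied between consecutive uses of the unknown operation (in a scheme
with `n` uses only `Ξ 0, …, Ξ (n - 2)` matter), a measurement `M` on `H' ⊗ K` with outcomes in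
`ℝ^l`, and a measurable function `T` of the outcome. -/
structure Estimator (m : ℕ) where
  κ : Type
  countable : Countable κ
  ρ : traceClass (WithAncilla H κ)
  isDensity : IsDensity ρ
  Ξ : ℕ → Superoperator (WithAncilla H' κ) (WithAncilla H κ)
  isCPTP : ∀ k, IsCPTP (Ξ k)
  l : ℕ
  M : POVM (EuclideanSpace ℝ (Fin l)) (WithAncilla H' κ)
  T : EuclideanSpace ℝ (Fin l) → Param m
  measurable : Measurable T

namespace Estimator

variable {m : ℕ}

/-- `(Φ_k ⊗ I) ∘ Ξ_{k-1} ∘ (Φ_{k-1} ⊗ I) ∘ ⋯ ∘ Ξ_0 ∘ (Φ_0 ⊗ I) (ρ)`. -/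
def iterate (e : Estimator H H' m) (Φ : ℕ → Superoperator H H') :
    ℕ → traceClass (WithAncilla H' e.κ)
  | 0 => ampliation (Φ 0) e.ρ
  | k + 1 => ampliation (Φ (k + 1)) (e.Ξ k (iterate e Φ k))

/-- The final state when `Φ_0, …, Φ_{n-1}` are used in this order (`n ≥ 1`). -/
def output (e : Estimator H H' m) (Φ : ℕ → Superoperator H H') (n : ℕ) :
    traceClass (WithAncilla H' e.κ) :=
  e.iterate Φ (n - 1)

/-- The distribution of the data after `n ≥ 1` uses of the operation `Λ`. -/
def law (e : Estimator H H' m) (Λ : Superoperator H H') (n : ℕ) :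
    Measure (EuclideanSpace ℝ (Fin e.l)) :=
  outcomeMeasure (e.output (fun _ => Λ) n) e.M

/-- The expectation of the estimate after `n ≥ 1` uses of `Λ`. -/
def expectation (e : Estimator H H' m) (Λ : Superoperator H H') (n : ℕ) : Param m :=
  ∫ ω, e.T ω ∂(e.law Λ n)

/-- The mean square error matrix `E (T^i - θ^i) (T^j - θ^j)` after `n ≥ 1` uses of `Λ`. -/
def mse (e : Estimator H H' m) (Λ : Superoperator H H') (θ : Param m) (n : ℕ) :
    Matrix (Fin m) (Fin m) ℝ :=
  fun i j => ∫ ω, (e.T ω i - θ i) * (e.T ω j - θ j) ∂(e.law Λ n)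

/-- The sum over `κ < n` of the final states in which the `κ`-th use of `Λ` is replaced
by `S`. -/
def outputReplacing (e : Estimator H H' m) (Λ S : Superoperator H H') (n : ℕ) :
    traceClass (WithAncilla H' e.κ) :=
  ∑ k ∈ Finset.range n, e.output (Function.update (fun _ => Λ) k S) n

end Estimator

section Model

variable {m : ℕ}

/-- `D` is the partial derivative at `θ` in the `i`-th coordinate of the family `Λ`, the limit being
taken in the norm `‖·‖_cb`. -/
def HasPartialDerivAt (Λ : Param m → Superoperator H H') (i : Fin m) (D : Superoperator H H')
    (θ : Param m) : Prop :=
  Tendsto (fun t : ℝ => cbNorm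
    (((t⁻¹ : ℝ) : ℂ) • (Λ (θ + t • EuclideanSpace.single i (1 : ℝ)) - Λ θ) - D)) (𝓝[≠] 0) (𝓝 0)

/-- Local uniform continuity on `Θ` in the norm `‖·‖_cb`. -/
def LocallyUniformlyContinuousOn (F : Param m → Superoperator H H') (Θ : Set (Param m)) : Prop :=
  ∀ θ₀ ∈ Θ, ∃ r > 0, ∀ ε : ℝ≥0∞, 0 < ε → ∃ δ > 0,
    ∀ θ ∈ Θ ∩ Metric.ball θ₀ r, ∀ θ' ∈ Θ ∩ Metric.ball θ₀ r,
      dist θ θ' < δ → cbNorm (F θ - F θ') < ε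

/-- The regularity condition on the model: `dΛ i = ∂_i Λ` and `ddΛ i j = ∂_i ∂_j Λ` exist on `Θ`,
are locally uniformly continuous, and are bounded by `a₁ / 2`. -/
structure RegularModel (Θ : Set (Param m)) (Λ : Param m → Superoperator H H')
    (dΛ : Fin m → Param m → Superoperator H H')
    (ddΛ : Fin m → Fin m → Param m → Superoperator H H') (a₁ : ℝ≥0) : Prop where
  hasDeriv : ∀ i, ∀ θ ∈ Θ, HasPartialDerivAt Λ i (dΛ i θ) θ
  hasDeriv₂ : ∀ i j, ∀ θ ∈ Θ, HasPartialDerivAt (dΛ j) i (ddΛ i j θ) θ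
  continuous : ∀ i, LocallyUniformlyContinuousOn (dΛ i) Θ
  continuous₂ : ∀ i j, LocallyUniformlyContinuousOn (ddΛ i j) Θ
  bound : ∀ i, ∀ θ ∈ Θ, cbNorm (dΛ i θ) ≤ ((a₁ / 2 : ℝ≥0) : ℝ≥0∞)
  bound₂ : ∀ i j, ∀ θ ∈ Θ, cbNorm (ddΛ i j θ) ≤ ((a₁ / 2 : ℝ≥0) : ℝ≥0∞)

/-- The maps `S i θ` are positive majorants of the derivatives near `θ`: for some `a₂ > 0`,
`(S i θ ⊗ I)(ρ) ≥ (∂_i Λ_{θ₀} ⊗ I)(ρ)` for all `ρ ≥ 0` whenever `‖θ₀ - θ‖ < a₂`. -/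
def IsMajorant (Θ : Set (Param m)) (dΛ : Fin m → Param m → Superoperator H H')
    (S : Fin m → Param m → Superoperator H H') : Prop :=
  ∃ a₂ > 0, ∀ i, ∀ θ ∈ Θ, IsCompletelyPositive (S i θ) ∧
    ∀ θ₀ ∈ Θ, ‖θ₀ - θ‖ < a₂ → IsCompletelyPositive (S i θ - dΛ i θ₀)

/-- The regularity condition on a sequence of estimators, the `n`-th of which uses the unknown
operation `n` times. -/
def RegularEstimators (Θ : Set (Param m)) (Λ : Param m → Superoperator H H')
    (dΛ : Fin m → Param m → Superoperator H H') (a₁ : ℝ≥0) (e : ℕ → Estimator H H' m) : Prop :=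
  ∃ S : Fin m → Param m → Superoperator H H', IsMajorant Θ dΛ S ∧
    ∀ n ≥ 1, ∃ a₄ : ℝ≥0, ∀ θ ∈ Θ,
      (∀ i, ∫⁻ ω, ‖(e n).T ω - θ‖ₑ
          ∂(outcomeMeasure ((e n).outputReplacing (Λ θ) (S i θ) n) (e n).M) ≤ n * a₁ * a₄) ∧
      ∫⁻ ω, ‖(e n).T ω - θ‖ₑ ^ 2 ∂((e n).law (Λ θ) n) ≤ n * (a₄ : ℝ≥0∞) ^ 2

/-- Asymptotic unbiasedness: for every `θ ∈ Θ`, `E_θ[T_n] → θ`, and the partial derivatives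
`∂_j E_θ[T_n^i]` exist and tend to `δ_ij`. -/
def AsymptoticallyUnbiased (Θ : Set (Param m)) (Λ : Param m → Superoperator H H')
    (e : ℕ → Estimator H H' m) : Prop :=
  ∀ θ ∈ Θ, Tendsto (fun n => (e n).expectation (Λ θ) n) atTop (𝓝 θ) ∧
    ∃ B : ℕ → Matrix (Fin m) (Fin m) ℝ,
      (∀ n ≥ 1, ∀ i j, HasLineDerivAt ℝ (fun θ' => (e n).expectation (Λ θ') n i) (B n i j) θ
        (EuclideanSpace.single j (1 : ℝ))) ∧
      Tendsto B atTop (𝓝 1)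

/-- The admissible sequences of estimators. -/
def Admissible (Θ : Set (Param m)) (Λ : Param m → Superoperator H H')
    (dΛ : Fin m → Param m → Superoperator H H') (a₁ : ℝ≥0) (e : ℕ → Estimator H H' m) : Prop :=
  AsymptoticallyUnbiased Θ Λ e ∧ RegularEstimators Θ Λ dΛ a₁ e

/-- The first-order asymptotic cost: the infimum of `limsup n Tr G MSE_θ[e_n]` over the admissible
sequences of estimators. -/
def asymptoticCost (Θ : Set (Param m)) (Λ : Param m → Superoperator H H')
    (dΛ : Fin m → Param m → Superoperator H H') (a₁ : ℝ≥0) (G : Matrix (Fin m) (Fin m) ℝ)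
    (θ : Param m) : ℝ≥0∞ :=
  ⨅ (e : ℕ → Estimator H H' m) (_ : Admissible Θ Λ dΛ a₁ e),
    limsup (fun n : ℕ => ENNReal.ofReal (n * (G * (e n).mse (Λ θ) θ n).trace)) atTop

end Model

end QuantumEstimation

end

/-! Under the positivity hypothesis, nearby channels are classical mixtures of the same two
channels, so `n` uses reveal no more than `n` coin tosses, and coin tosses obey the `1/n` law.

Fix a coordinate `j` and `0 < δ < ε`, so that `Λ_θ ± δ ∂_j Λ_θ` is completely positive on all of
`Θ`. Every functional of superoperators that is nonnegative on completely positive maps then gives a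
function `u(s)` of `Λ_{θ + s e_j}` with `|u'| ≤ u / δ`. By Grönwall, `|u(t) - u(0)| ≤ r u(0)` with
`r = 2t/δ`, for small `t`. Hence `Λ_θ ± r⁻¹ (Λ_{θ + t e_j} - Λ_θ)` are again quantum operations
(`isCPTP_add_sub`), and `Λ_θ` and `Λ_{θ + t e_j}` mix these two with weights `(1/2, 1/2)` and
`((1+r)/2, (1-r)/2)`.

Each use of the unknown channel thus costs one independent bit, whatever the adaptive strategy. The
likelihood ratio of a bit has second moment `1 + r²`, that of `n` bits `(1 + r²)^n`
(`Estimator.isSimulation_output`). The Chapman-Robbins inequality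
(`IsSimulation.sq_integral_sub_le`) bounds the change of the mean of `w · (T - θ)` between `θ` and
`θ + t e_j`; dividing by `t` and letting `t → 0` gives a Cramér-Rao bound linear in `n`
(`Estimator.sq_deriv_le`). Asymptotic unbiasedness makes its left side tend to `w_j²`. With `G =
CᵀC` and `w` a row of `C` with `w_j ≠ 0`, `n Tr G MSE` is eventually above a positive constant that
does not depend on the sequence (`exists_pos_le_trace_mul_mse`).

Most of the preliminary work makes ampliations to infinite ancillas and outcome distributions
usable: both are defined by choice, so existence has to be proved, and for ampliations uniqueness
too. -/

noncomputable section

namespace QuantumEstimation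

open scoped ComplexOrder

/-! ### The trace of positive and of trace-class operators -/

section Trace

variable {E : Type*} [NormedAddCommGroup E] [InnerProductSpace ℂ E] [CompleteSpace E]

omit [CompleteSpace E] in
theorem isPositive_iff_inner_nonneg {A : E →L[ℂ] E} : A.IsPositive ↔ ∀ x, 0 ≤ ⟪x, A x⟫_ℂ := by
  refine ⟨fun h x => h.inner_nonneg_right x, fun h => ?_⟩
  rw [ContinuousLinearMap.isPositive_iff_complex]
  intro x
  have h1 := Complex.nonneg_iff.1 (h x)
  have h2 : ⟪A x, x⟫_ℂ = ⟪x, A x⟫_ℂ := by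
    rw [← inner_conj_symm, Complex.conj_eq_iff_im]
    exact h1.2.symm
  rw [h2]
  exact ⟨Complex.ext rfl h1.2, h1.1⟩

theorem traceNorm_of_isPositive {A : E →L[ℂ] E} (hA : A.IsPositive) : traceNorm A = posTrace A := by
  rw [traceNorm, CFC.abs_of_nonneg A ((ContinuousLinearMap.nonneg_iff_isPositive A).2 hA)]

theorem exists_sqrt {A : E →L[ℂ] E} (hA : A.IsPositive) :
    ∃ R : E →L[ℂ] E, R * R = A ∧ ∀ v w, ⟪R v, w⟫_ℂ = ⟪v, R w⟫_ℂ := by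
  have hA' := (ContinuousLinearMap.nonneg_iff_isPositive A).2 hA
  refine ⟨CFC.sqrt A, CFC.sqrt_mul_sqrt_self _ hA', fun v w => ?_⟩
  rw [← ContinuousLinearMap.adjoint_inner_right, ← ContinuousLinearMap.star_eq_adjoint,
    (IsSelfAdjoint.of_nonneg (CFC.sqrt_nonneg A)).star_eq]

omit [CompleteSpace E] in
theorem ofReal_re_inner_mul_self {R : E →L[ℂ] E} (hR : ∀ v w, ⟪R v, w⟫_ℂ = ⟪v, R w⟫_ℂ) (v : E) :
    ENNReal.ofReal (RCLike.re ⟪v, (R * R) v⟫_ℂ) = ‖R v‖ₑ ^ 2 := by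
  change ENNReal.ofReal (RCLike.re ⟪v, R (R v)⟫_ℂ) = _
  rw [← hR, inner_self_eq_norm_sq, ENNReal.ofReal_pow (norm_nonneg _), ofReal_norm]


/-- `f` is a Parseval family: `∑ |⟨f_i, v⟩|² = ‖v‖²`. -/
def IsParseval {ι E : Type*} [NormedAddCommGroup E] [InnerProductSpace ℂ E] (f : ι → E) : Prop :=
  ∀ v, ∑' i, ‖⟪f i, v⟫_ℂ‖ₑ ^ 2 = ‖v‖ₑ ^ 2

variable (E) in
theorem isParseval_basis : IsParseval (fun i => basis E i) := by
  intro v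
  have h2 := ((basis E).hasSum_inner_mul_inner v v).mapL Complex.reCLM
  have h3 : Complex.reCLM ⟪v, v⟫_ℂ = ‖v‖ ^ 2 := inner_self_eq_norm_sq (𝕜 := ℂ) v
  rw [h3] at h2
  have h4 : ∀ i, Complex.reCLM (⟪v, basis E i⟫_ℂ * ⟪basis E i, v⟫_ℂ) = ‖⟪basis E i, v⟫_ℂ‖ ^ 2 := by
    intro i
    rw [← inner_conj_symm, ← Complex.normSq_eq_conj_mul_self, Complex.reCLM_apply,
      Complex.ofReal_re, Complex.normSq_eq_norm_sq]
  simp only [h4] at h2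
  rw [← ofReal_norm, ← ENNReal.ofReal_pow (norm_nonneg _), ← h2.tsum_eq,
    ENNReal.ofReal_tsum_of_nonneg (fun i => by positivity) h2.summable]
  simp only [ENNReal.ofReal_pow (norm_nonneg _), ofReal_norm]

/-- With `A = R²` both sides equal the double sum `∑ |⟨f_i, R e_j⟩|²`, by Tonelli. This frees the
trace from the chosen basis, so that it can be computed in a basis adapted to the ancilla. -/
theorem posTrace_eq_tsum {ι : Type*} {f : ι → E} (hf : IsParseval f) {A : E →L[ℂ] E}
    (hA : A.IsPositive) : posTrace A = ∑' i, ENNReal.ofReal (RCLike.re ⟪f i, A (f i)⟫_ℂ) := by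
  obtain ⟨R, rfl, hR⟩ := exists_sqrt hA
  simp only [posTrace, ofReal_re_inner_mul_self hR]
  calc ∑' j, ‖R (basis E j)‖ₑ ^ 2 = ∑' j, ∑' i, ‖⟪f i, R (basis E j)⟫_ℂ‖ₑ ^ 2 := by simp only [hf _]
    _ = ∑' i, ∑' j, ‖⟪f i, R (basis E j)⟫_ℂ‖ₑ ^ 2 := ENNReal.tsum_comm
    _ = ∑' i, ∑' j, ‖⟪basis E j, R (f i)⟫_ℂ‖ₑ ^ 2 := by
      refine tsum_congr fun i => tsum_congr fun j => ?_
      rw [← hR, ← inner_conj_symm, RCLike.enorm_conj]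
    _ = ∑' i, ‖R (f i)‖ₑ ^ 2 := by simp only [isParseval_basis E _]

theorem enorm_sq_sqrt_le {R : E →L[ℂ] E} (hR : ∀ v w, ⟪R v, w⟫_ℂ = ⟪v, R w⟫_ℂ) (v : E) :
    ‖R v‖ₑ ^ 2 ≤ posTrace (R * R) * ‖v‖ₑ ^ 2 := by
  rw [← isParseval_basis E, posTrace, ← ENNReal.tsum_mul_right]
  refine ENNReal.tsum_le_tsum fun i => ?_
  rw [ofReal_re_inner_mul_self hR, ← hR, ← mul_pow]
  gcongr
  simpa only [← ofReal_norm, ← ENNReal.ofReal_mul (norm_nonneg _)] using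
    ENNReal.ofReal_le_ofReal (norm_inner_le_norm (𝕜 := ℂ) (R (basis E i)) v)

theorem enorm_apply_le_posTrace {A : E →L[ℂ] E} (hA : A.IsPositive) (v : E) :
    ‖A v‖ₑ ≤ posTrace A * ‖v‖ₑ := by
  obtain ⟨R, rfl, hR⟩ := exists_sqrt hA
  rw [← ENNReal.pow_le_pow_left_iff two_ne_zero]
  calc ‖R (R v)‖ₑ ^ 2 ≤ posTrace (R * R) * (posTrace (R * R) * ‖v‖ₑ ^ 2) :=
        (enorm_sq_sqrt_le hR _).trans (by gcongr; exact enorm_sq_sqrt_le hR _)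
    _ = (posTrace (R * R) * ‖v‖ₑ) ^ 2 := by ring

theorem enorm_apply_le_traceNorm (A : E →L[ℂ] E) (v : E) : ‖A v‖ₑ ≤ traceNorm A * ‖v‖ₑ := by
  have h := enorm_apply_le_posTrace
    ((ContinuousLinearMap.nonneg_iff_isPositive _).1 (CFC.abs_nonneg A)) v
  rwa [← ofReal_norm, norm_abs_apply, ofReal_norm] at h

/-- The vectors are `x_i = √A e_i`: a positive trace-class operator is a sum of unnormalised pure
states. -/
theorem exists_hasNuclearSum_self {A : E →L[ℂ] E} (hA : A.IsPositive) (h : posTrace A < ∞) :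
    ∃ x : basisIndex E → E, HasNuclearSum A x x := by
  obtain ⟨R, rfl, hR⟩ := exists_sqrt hA
  refine ⟨fun i => R (basis E i), ?_, fun v => ?_⟩
  · simpa only [posTrace, ofReal_re_inner_mul_self hR, sq] using h
  · have h1 := ((basis E).hasSum_repr (R v)).mapL R
    simp only [map_smul, HilbertBasis.repr_apply_apply, ← hR] at h1
    exact h1

theorem HasNuclearSum.summable_inner_basis {ι : Type*} {A : E →L[ℂ] E} {x y : ι → E}
    (h : HasNuclearSum A x y) :
    Summable fun p : ι × basisIndex E => ⟪y p.1, basis E p.2⟫_ℂ * ⟪basis E p.2, x p.1⟫_ℂ := by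
  refine Summable.of_enorm ?_
  rw [ENNReal.tsum_prod']
  refine ne_of_lt (lt_of_le_of_lt (ENNReal.tsum_le_tsum fun i => ?_) h.1)
  simp only [enorm_mul]
  rw [mul_comm ‖x i‖ₑ]
  exact tsum_enorm_inner_mul_le _ _

/-- Fubini for the absolutely summable family `⟨y_i, e_j⟩⟨e_j, x_i⟩`: summing over `j` first gives
the first series, over `i` first the second. -/
theorem HasNuclearSum.hasSum_trace {ι : Type*} {A : E →L[ℂ] E} {x y : ι → E}
    (h : HasNuclearSum A x y) :
    HasSum (fun i => ⟪y i, x i⟫_ℂ) (trace A) ∧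
      HasSum (fun j => ⟪basis E j, A (basis E j)⟫_ℂ) (trace A) := by
  have ht := h.summable_inner_basis.hasSum
  have h1 := ht.prod_fiberwise fun i => (basis E).hasSum_inner_mul_inner (y i) (x i)
  have h3 := (Equiv.prodComm (basisIndex E) ι).hasSum_iff.2 ht
  have h2 := h3.prod_fiberwise (g := fun j => ⟪basis E j, A (basis E j)⟫_ℂ) fun j => by
    have h4 := (h.2 (basis E j)).mapL (innerSL ℂ (basis E j))
    simp only [innerSL_apply_apply, inner_smul_right] at h4
    exact h4
  have h5 := h2.tsum_eq
  rw [trace, h5]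
  exact ⟨h1, h2⟩

theorem hasSum_trace (A : traceClass E) :
    HasSum (fun j => ⟪basis E j, (A : E →L[ℂ] E) (basis E j)⟫_ℂ) (trace (A : E →L[ℂ] E)) := by
  obtain ⟨x, y, h⟩ := exists_hasNuclearSum A.2
  exact h.hasSum_trace.2

theorem posTrace_lt_top {A : traceClass E} (hA : (A : E →L[ℂ] E).IsPositive) :
    posTrace (A : E →L[ℂ] E) < ∞ :=
  traceNorm_of_isPositive hA ▸ A.2

theorem mem_traceClass_of_isPositive {A : E →L[ℂ] E} (hA : A.IsPositive) (h : posTrace A < ∞) :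
    A ∈ traceClass E :=
  (traceNorm_of_isPositive hA).trans_lt h

theorem trace_eq_posTrace {A : traceClass E} (hA : (A : E →L[ℂ] E).IsPositive) :
    trace (A : E →L[ℂ] E) = ((posTrace (A : E →L[ℂ] E)).toReal : ℂ) := by
  have h := hasSum_trace A
  have h0 : ∀ i, 0 ≤ ⟪basis E i, (A : E →L[ℂ] E) (basis E i)⟫_ℂ := fun i => hA.inner_nonneg_right _
  have h1 : HasSum (fun j => RCLike.re ⟪basis E j, (A : E →L[ℂ] E) (basis E j)⟫_ℂ)
      (trace (A : E →L[ℂ] E)).re := h.mapL Complex.reCLM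
  have h2 : posTrace (A : E →L[ℂ] E) = ENNReal.ofReal (trace (A : E →L[ℂ] E)).re := by
    rw [posTrace, ← h1.tsum_eq]
    exact (ENNReal.ofReal_tsum_of_nonneg
      (fun i => (Complex.nonneg_iff.1 (h0 i)).1) h1.summable).symm
  have h3 := Complex.nonneg_iff.1 (h.nonneg h0)
  rw [h2, ENNReal.toReal_ofReal h3.1]
  exact Complex.ext rfl h3.2.symm

theorem trace_eq_trace_iff {F : Type*} [NormedAddCommGroup F] [InnerProductSpace ℂ F]
    [CompleteSpace F] {A : traceClass E} (hA : (A : E →L[ℂ] E).IsPositive)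
    {B : traceClass F} (hB : (B : F →L[ℂ] F).IsPositive) :
    trace (A : E →L[ℂ] E) = trace (B : F →L[ℂ] F) ↔
      posTrace (A : E →L[ℂ] E) = posTrace (B : F →L[ℂ] F) := by
  rw [trace_eq_posTrace hA, trace_eq_posTrace hB, Complex.ofReal_inj,
    ENNReal.toReal_eq_toReal_iff' (posTrace_lt_top hA).ne (posTrace_lt_top hB).ne]

theorem comp_mem_traceClass (A : traceClass E) (M : E →L[ℂ] E) :
    (A : E →L[ℂ] E) ∘L M ∈ traceClass E :=
  comp_comp_mem_traceClass (ContinuousLinearMap.id ℂ E) A M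

/-- The linear functional `A ↦ tr A M` on the trace-class operators. -/
def traceMul (M : E →L[ℂ] E) : traceClass E →ₗ[ℂ] ℂ where
  toFun A := trace ((A : E →L[ℂ] E) ∘L M)
  map_add' A B := by
    have h := (hasSum_trace ⟨_, comp_mem_traceClass A M⟩).add
      (hasSum_trace ⟨_, comp_mem_traceClass B M⟩)
    refine (hasSum_trace ⟨_, comp_mem_traceClass (A + B) M⟩).unique ?_
    simpa [inner_add_right] using h
  map_smul' c A := by
    have h := (hasSum_trace ⟨_, comp_mem_traceClass A M⟩).mul_left c
    refine (hasSum_trace ⟨_, comp_mem_traceClass (c • A) M⟩).unique ?_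
    simpa [inner_smul_right] using h

theorem traceMul_one (A : traceClass E) : traceMul 1 A = trace (A : E →L[ℂ] E) := rfl

end Trace

/-! ### Block operators on `H ⊗ ℓ²(κ)` -/

section Blocks

variable {H : Type*} [NormedAddCommGroup H] [InnerProductSpace ℂ H]
variable {κ : Type}

open Classical in
/-- The embedding `φ ↦ φ ⊗ e_k`. -/
def inj (k : κ) : H →L[ℂ] WithAncilla H κ :=
  lp.singleContinuousLinearMap ℂ (fun _ : κ => H) 2 k

/-- The coordinate map `⟨e_k|`. -/
def proj (k : κ) : WithAncilla H κ →L[ℂ] H := lp.evalCLM ℂ (fun _ : κ => H) 2 k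

theorem inner_inj_left (k : κ) (a : H) (v : WithAncilla H κ) : ⟪inj k a, v⟫_ℂ = ⟪a, v k⟫_ℂ := by
  classical
  exact lp.inner_single_left (𝕜 := ℂ) k a v

theorem inner_inj_right (k : κ) (a : H) (v : WithAncilla H κ) : ⟪v, inj k a⟫_ℂ = ⟪v k, a⟫_ℂ := by
  classical
  exact lp.inner_single_right (𝕜 := ℂ) k a v

open Classical in
theorem inj_apply (k l : κ) (a : H) : (inj k a : WithAncilla H κ) l = if l = k then a else 0 := by
  by_cases h : l = k
  · subst h
    simp [inj]
  · simp [inj, h]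

theorem hasSum_inj (v : WithAncilla H κ) : HasSum (fun k => inj k (v k)) v := by
  classical
  exact lp.hasSum_single (by simp) v

theorem enorm_sq_eq_tsum (v : WithAncilla H κ) : ‖v‖ₑ ^ 2 = ∑' k, ‖v k‖ₑ ^ 2 := by
  have h := (lp.hasSum_inner (𝕜 := ℂ) v v).mapL Complex.reCLM
  have h1 : Complex.reCLM ⟪v, v⟫_ℂ = ‖v‖ ^ 2 := inner_self_eq_norm_sq (𝕜 := ℂ) v
  have h2 : ∀ k, Complex.reCLM ⟪v k, v k⟫_ℂ = ‖v k‖ ^ 2 :=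
    fun k => inner_self_eq_norm_sq (𝕜 := ℂ) (v k)
  simp only [h1, h2] at h
  rw [← ofReal_norm, ← ENNReal.ofReal_pow (norm_nonneg _), ← h.tsum_eq,
    ENNReal.ofReal_tsum_of_nonneg (fun i => by positivity) h.summable]
  simp only [ENNReal.ofReal_pow (norm_nonneg _), ofReal_norm]

variable [CompleteSpace H]

variable (H κ) in
theorem isParseval_inj :
    IsParseval (fun p : κ × basisIndex H => (inj p.1 (basis H p.2) : WithAncilla H κ)) := by
  intro v
  simp only [inner_inj_left]
  rw [ENNReal.tsum_prod', enorm_sq_eq_tsum]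
  exact tsum_congr fun k => isParseval_basis H (v k)

theorem inner_block (A : traceClass (WithAncilla H κ)) (k l : κ) (x y : H) :
    ⟪x, (block A k l : H →L[ℂ] H) y⟫_ℂ =
      ⟪inj k x, (A : WithAncilla H κ →L[ℂ] WithAncilla H κ) (inj l y)⟫_ℂ := by
  rw [inner_inj_left]
  rfl

theorem block_add (A B : traceClass (WithAncilla H κ)) (k l : κ) :
    block (A + B) k l = block A k l + block B k l := by
  refine Subtype.ext (ContinuousLinearMap.ext fun x => ?_)
  rfl

theorem block_smul (c : ℂ) (A : traceClass (WithAncilla H κ)) (k l : κ) :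
    block (c • A) k l = c • block A k l := by
  refine Subtype.ext (ContinuousLinearMap.ext fun x => ?_)
  rfl

/-- The block map as a linear map. -/
def blockₗ (k l : κ) : traceClass (WithAncilla H κ) →ₗ[ℂ] traceClass H where
  toFun A := block A k l
  map_add' A B := block_add A B k l
  map_smul' c A := block_smul c A k l

theorem blockₗ_apply (A : traceClass (WithAncilla H κ)) (k l : κ) : blockₗ k l A = block A k l :=
  rfl

/-- The finite block operator with block `b k l` at the positions `k, l ∈ F`. -/
def ofBlocks (F : Finset κ) (b : κ → κ → traceClass H) :
    traceClass (WithAncilla H κ) :=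
  ∑ k ∈ F, ∑ l ∈ F, ⟨inj k ∘L (b k l : H →L[ℂ] H) ∘L proj l, comp_comp_mem_traceClass _ _ _⟩

theorem inner_ofBlocks (F : Finset κ) (b : κ → κ → traceClass H) (x y : WithAncilla H κ) :
    ⟪x, (ofBlocks F b : WithAncilla H κ →L[ℂ] WithAncilla H κ) y⟫_ℂ =
      ∑ k ∈ F, ∑ l ∈ F, ⟪x k, (b k l : H →L[ℂ] H) (y l)⟫_ℂ := by
  simp only [ofBlocks, AddSubmonoidClass.coe_finsetSum, sum_apply, inner_sum]
  refine Finset.sum_congr rfl fun k _ => Finset.sum_congr rfl fun l _ => ?_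
  exact inner_inj_right k _ x |>.symm ▸ rfl

open Classical in
theorem block_ofBlocks (F : Finset κ) (b : κ → κ → traceClass H) (k l : κ) :
    block (ofBlocks F b) k l = if k ∈ F ∧ l ∈ F then b k l else 0 := by
  refine Subtype.ext (ContinuousLinearMap.ext fun y => ext_inner_left ℂ fun x => ?_)
  rw [inner_block, inner_ofBlocks]
  simp only [inj_apply]
  have h1 : ∀ k' l', ⟪if k' = k then x else 0, (b k' l' : H →L[ℂ] H) (if l' = l then y else 0)⟫_ℂ =
      if k' = k then if l' = l then ⟪x, (b k l : H →L[ℂ] H) y⟫_ℂ else 0 else 0 := by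
    intro k' l'
    split_ifs with h h' <;> simp_all
  simp only [h1]
  by_cases hk : k ∈ F <;> by_cases hl : l ∈ F <;> simp [hk, hl]

theorem inner_sum_inj (A : traceClass (WithAncilla H κ)) (F : Finset κ) (x y : κ → H) :
    ⟪∑ k ∈ F, inj k (x k), (A : WithAncilla H κ →L[ℂ] WithAncilla H κ) (∑ l ∈ F, inj l (y l))⟫_ℂ =
      ∑ k ∈ F, ∑ l ∈ F, ⟪x k, (block A k l : H →L[ℂ] H) (y l)⟫_ℂ := by
  simp only [map_sum, sum_inner, inner_sum, inner_block]
  exact Finset.sum_comm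

/-- Truncations of `x` and `y` to finitely many coordinates converge in norm. Equality and
positivity of operators on an infinite composite system thereby reduce to finite block sums. -/
theorem tendsto_sum_inner_block (A : traceClass (WithAncilla H κ)) (x y : WithAncilla H κ) :
    Tendsto (fun F : Finset κ => ∑ k ∈ F, ∑ l ∈ F, ⟪x k, (block A k l : H →L[ℂ] H) (y l)⟫_ℂ) atTop
      (𝓝 ⟪x, (A : WithAncilla H κ →L[ℂ] WithAncilla H κ) y⟫_ℂ) := by
  simp only [← inner_sum_inj A _ (fun k => x k) (fun k => y k)]
  exact (hasSum_inj x).inner ((A : WithAncilla H κ →L[ℂ] WithAncilla H κ).continuous.tendsto _ |>.comp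
    (hasSum_inj y))

theorem ext_block {A B : traceClass (WithAncilla H κ)} (h : ∀ k l, block A k l = block B k l) :
    A = B := by
  refine Subtype.ext (ContinuousLinearMap.ext fun y => ext_inner_left ℂ fun x => ?_)
  have h1 := tendsto_sum_inner_block A x y
  simp only [h] at h1
  exact tendsto_nhds_unique h1 (tendsto_sum_inner_block B x y)

theorem isPositive_of_block {A : traceClass (WithAncilla H κ)}
    (h : ∀ (F : Finset κ) (x : κ → H), 0 ≤ ∑ k ∈ F, ∑ l ∈ F, ⟪x k, (block A k l : H →L[ℂ] H) (x l)⟫_ℂ) :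
    (A : WithAncilla H κ →L[ℂ] WithAncilla H κ).IsPositive :=
  isPositive_iff_inner_nonneg.2 fun x =>
    ge_of_tendsto' (tendsto_sum_inner_block A x x) fun F => h F (fun k => x k)

theorem sum_inner_block_nonneg {A : traceClass (WithAncilla H κ)}
    (hA : (A : WithAncilla H κ →L[ℂ] WithAncilla H κ).IsPositive) (F : Finset κ) (x : κ → H) :
    0 ≤ ∑ k ∈ F, ∑ l ∈ F, ⟪x k, (block A k l : H →L[ℂ] H) (x l)⟫_ℂ :=
  inner_sum_inj A F x x ▸ hA.inner_nonneg_right _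

theorem isPositive_block {A : traceClass (WithAncilla H κ)}
    (hA : (A : WithAncilla H κ →L[ℂ] WithAncilla H κ).IsPositive) (k : κ) :
    (block A k k : H →L[ℂ] H).IsPositive :=
  isPositive_iff_inner_nonneg.2 fun x => inner_block A k k x x ▸ hA.inner_nonneg_right _

/-- `A` is only assumed bounded, because this formula is also what shows that a weak limit is
trace-class. -/
theorem posTrace_eq_tsum_of_blocks {A : WithAncilla H κ →L[ℂ] WithAncilla H κ} (hA : A.IsPositive)
    {a : κ → H →L[ℂ] H} (h : ∀ k x, ⟪inj k x, A (inj k x)⟫_ℂ = ⟪x, a k x⟫_ℂ) :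
    posTrace A = ∑' k, posTrace (a k) := by
  rw [posTrace_eq_tsum (isParseval_inj H κ) hA, ENNReal.tsum_prod']
  simp only [h, posTrace]

theorem posTrace_eq_tsum_block {A : traceClass (WithAncilla H κ)}
    (hA : (A : WithAncilla H κ →L[ℂ] WithAncilla H κ).IsPositive) :
    posTrace (A : WithAncilla H κ →L[ℂ] WithAncilla H κ) =
      ∑' k, posTrace (block A k k : H →L[ℂ] H) :=
  posTrace_eq_tsum_of_blocks hA fun k x => (inner_block A k k x x).symm

end Blocks

/-! ### Existence and uniqueness of ampliations of quantum operations -/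

section Ampliation

variable {H : Type*} [NormedAddCommGroup H] [InnerProductSpace ℂ H] [CompleteSpace H]
variable {H' : Type*} [NormedAddCommGroup H'] [InnerProductSpace ℂ H'] [CompleteSpace H']
variable {κ : Type} {Λ : Superoperator H H'}

theorem isPositive_ofBlocks {A : traceClass (WithAncilla H κ)}
    (hA : (A : WithAncilla H κ →L[ℂ] WithAncilla H κ).IsPositive) (F : Finset κ) :
    (ofBlocks F (block A) : WithAncilla H κ →L[ℂ] WithAncilla H κ).IsPositive :=
  isPositive_iff_inner_nonneg.2 fun x =>
    inner_ofBlocks F (block A) x x ▸ sum_inner_block_nonneg hA F (fun k => x k)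

/-- Complete positivity says something about `A` only if an ampliation of `A` exists. For a finite
truncation it always does, for any linear `Λ`. -/
theorem isAmpliation_ofBlocks (Λ : Superoperator H H') (A : traceClass (WithAncilla H κ))
    (F : Finset κ) :
    IsAmpliation Λ (ofBlocks F (block A)) (ofBlocks F fun k l => Λ (block A k l)) := by
  classical
  intro k l
  simp only [block_ofBlocks]
  split_ifs <;> simp

theorem IsCompletelyPositive.isPositive_ofBlocks [Countable κ] (hΛ : IsCompletelyPositive Λ)
    {A : traceClass (WithAncilla H κ)}
    (hA : (A : WithAncilla H κ →L[ℂ] WithAncilla H κ).IsPositive) (F : Finset κ) :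
    (ofBlocks F (fun k l => Λ (block A k l)) :
      WithAncilla H' κ →L[ℂ] WithAncilla H' κ).IsPositive :=
  hΛ κ _ _ (isAmpliation_ofBlocks Λ A F) (QuantumEstimation.isPositive_ofBlocks hA F)

theorem IsCompletelyPositive.sum_inner_nonneg [Countable κ] (hΛ : IsCompletelyPositive Λ)
    {A : traceClass (WithAncilla H κ)}
    (hA : (A : WithAncilla H κ →L[ℂ] WithAncilla H κ).IsPositive) (F : Finset κ) (x : κ → H') :
    0 ≤ ∑ k ∈ F, ∑ l ∈ F, ⟪x k, (Λ (block A k l) : H' →L[ℂ] H') (x l)⟫_ℂ := by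
  classical
  have h := sum_inner_block_nonneg (hΛ.isPositive_ofBlocks hA F) F x
  refine h.trans_eq (Finset.sum_congr rfl fun k hk => Finset.sum_congr rfl fun l hl => ?_)
  rw [block_ofBlocks, if_pos ⟨hk, hl⟩]

/-- Together with `IsCompletelyPositive.sum_inner_nonneg`, this describes complete positivity by
scalar inequalities linear in `Λ`, the form to which a differential inequality applies. -/
theorem isCompletelyPositive_of_sum_inner_nonneg
    (h : ∀ (κ : Type) [Countable κ] (A : traceClass (WithAncilla H κ)),
      (A : WithAncilla H κ →L[ℂ] WithAncilla H κ).IsPositive → ∀ (F : Finset κ) (x : κ → H'),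
      0 ≤ ∑ k ∈ F, ∑ l ∈ F, ⟪x k, (Λ (block A k l) : H' →L[ℂ] H') (x l)⟫_ℂ) :
    IsCompletelyPositive Λ := by
  intro κ _ A B hAB hA
  refine isPositive_of_block fun F x => ?_
  simp only [hAB _ _]
  exact h κ A hA F x

theorem IsCompletelyPositive.isPositive_apply (hΛ : IsCompletelyPositive Λ) {a : traceClass H}
    (ha : (a : H →L[ℂ] H).IsPositive) : (Λ a : H' →L[ℂ] H').IsPositive := by
  classical
  have hA : (ofBlocks {()} (fun _ _ : Unit => a) :
      WithAncilla H Unit →L[ℂ] WithAncilla H Unit).IsPositive := by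
    refine isPositive_iff_inner_nonneg.2 fun x => ?_
    simpa [inner_ofBlocks] using ha.inner_nonneg_right _
  refine isPositive_iff_inner_nonneg.2 fun x => ?_
  simpa [block_ofBlocks] using hΛ.sum_inner_nonneg hA {()} fun _ => x

theorem IsCPTP.posTrace_apply (hΛ : IsCPTP Λ) {a : traceClass H} (ha : (a : H →L[ℂ] H).IsPositive) :
    posTrace (Λ a : H' →L[ℂ] H') = posTrace (a : H →L[ℂ] H) :=
  (trace_eq_trace_iff (hΛ.1.isPositive_apply ha) ha).1 (hΛ.2 a)

theorem IsCPTP.posTrace_ofBlocks_le [Countable κ] (hΛ : IsCPTP Λ)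
    {A : traceClass (WithAncilla H κ)}
    (hA : (A : WithAncilla H κ →L[ℂ] WithAncilla H κ).IsPositive) (F : Finset κ) :
    posTrace (ofBlocks F (fun k l => Λ (block A k l)) :
      WithAncilla H' κ →L[ℂ] WithAncilla H' κ) ≤
        posTrace (A : WithAncilla H κ →L[ℂ] WithAncilla H κ) := by
  classical
  rw [posTrace_eq_tsum_block hA, posTrace_eq_tsum_block (hΛ.1.isPositive_ofBlocks hA F)]
  refine ENNReal.tsum_le_tsum fun k => ?_
  rw [block_ofBlocks]
  split_ifs with h
  · exact (hΛ.posTrace_apply (isPositive_block hA k)).le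
  · simp [posTrace]

/-- A bounded net of operators has a weak operator limit along an ultrafilter. -/
theorem exists_weak_limit {E ι : Type*} [NormedAddCommGroup E] [InnerProductSpace ℂ E]
    [CompleteSpace E] (U : Ultrafilter ι) (B : ι → E →L[ℂ] E) (C : ℝ)
    (hB : ∀ i v, ‖B i v‖ ≤ C * ‖v‖) :
    ∃ T : E →L[ℂ] E, ∀ x y, Tendsto (fun i => ⟪x, B i y⟫_ℂ) U (𝓝 ⟪x, T y⟫_ℂ) := by
  have hbd : ∀ i x y, ‖⟪x, B i y⟫_ℂ‖ ≤ C * ‖x‖ * ‖y‖ := fun i x y =>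
    (norm_inner_le_norm _ _).trans ((mul_le_mul_of_nonneg_left (hB i y) (norm_nonneg x)).trans_eq
      (by ring))
  have hlim : ∀ x y, ∃ z ∈ Metric.closedBall (0 : ℂ) (C * ‖x‖ * ‖y‖),
      Tendsto (fun i => ⟪x, B i y⟫_ℂ) U (𝓝 z) := by
    intro x y
    -- Each matrix element stays in a compact disc, so it converges along the ultrafilter; the
    -- limits form a bounded sesquilinear form, hence come from an operator.
    refine (isCompact_closedBall (0 : ℂ) (C * ‖x‖ * ‖y‖)).ultrafilter_le_nhds
      (U.map fun i => ⟪x, B i y⟫_ℂ) ?_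
    rw [le_principal_iff]
    exact Filter.mem_map.2 (Filter.univ_mem' fun i => by simpa using hbd i x y)
  choose g hg hgt using hlim
  let S : E →L⋆[ℂ] E →L[ℂ] ℂ := LinearMap.mkContinuous₂ (LinearMap.mk₂'ₛₗ (starRingEnd ℂ) (RingHom.id ℂ) g
    (fun x x' y => tendsto_nhds_unique (hgt _ _) (by simpa [inner_add_left] using (hgt x y).add (hgt x' y)))
    (fun c x y => tendsto_nhds_unique (hgt _ _)
      (by simpa [inner_smul_left, mul_comm] using (hgt x y).const_mul (starRingEnd ℂ c)))
    (fun x y y' => tendsto_nhds_unique (hgt _ _) (by simpa [inner_add_right] using (hgt x y).add (hgt x y')))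
    (fun c x y => tendsto_nhds_unique (hgt _ _)
      (by simpa [inner_smul_right] using (hgt x y).const_mul c))) C
    (fun x y => by simpa using hg x y)
  refine ⟨ContinuousLinearMap.adjoint (InnerProductSpace.continuousLinearMapOfBilin S), fun x y => ?_⟩
  rw [ContinuousLinearMap.adjoint_inner_right, InnerProductSpace.continuousLinearMapOfBilin_apply]
  exact hgt x y

/-- The finite truncations of the candidate are positive and bounded by `tr A`, so they have a weak
limit. It has the right blocks, and its trace is the sum of the traces of the diagonal blocks, which
`Λ` preserves. -/
theorem IsCPTP.exists_isAmpliation [Countable κ] (hΛ : IsCPTP Λ)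
    {A : traceClass (WithAncilla H κ)}
    (hA : (A : WithAncilla H κ →L[ℂ] WithAncilla H κ).IsPositive) :
    ∃ B : traceClass (WithAncilla H' κ), IsAmpliation Λ A B := by
  classical
  set b : κ → κ → traceClass H' := fun k l => Λ (block A k l) with hb
  have hpos := hΛ.1.isPositive_ofBlocks hA
  have hbd : ∀ (F : Finset κ) v, ‖(ofBlocks F b : WithAncilla H' κ →L[ℂ] WithAncilla H' κ) v‖ ≤
      (posTrace (A : WithAncilla H κ →L[ℂ] WithAncilla H κ)).toReal * ‖v‖ := by
    intro F v
    have h1 := (enorm_apply_le_posTrace (hpos F) v).trans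
      (mul_le_mul_left (hΛ.posTrace_ofBlocks_le hA F) _)
    have h2 := ENNReal.toReal_mono (ENNReal.mul_lt_top (posTrace_lt_top hA) (by simp)).ne h1
    simpa [ENNReal.toReal_mul] using h2
  obtain ⟨T, hT⟩ := exists_weak_limit (Ultrafilter.of (atTop : Filter (Finset κ)))
    (fun F => (ofBlocks F b : WithAncilla H' κ →L[ℂ] WithAncilla H' κ)) _ hbd
  have hle : (Ultrafilter.of (atTop : Filter (Finset κ)) : Filter (Finset κ)) ≤ atTop :=
    Ultrafilter.of_le _
  have hTpos : T.IsPositive := isPositive_iff_inner_nonneg.2 fun x =>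
    ge_of_tendsto' (hT x x) fun F => (hpos F).inner_nonneg_right x
  have hTb : ∀ k l x y, ⟪inj k x, T (inj l y)⟫_ℂ = ⟪x, (b k l : H' →L[ℂ] H') y⟫_ℂ := by
    intro k l x y
    refine tendsto_nhds_unique (hT _ _) ?_
    refine (tendsto_congr' ?_).1 tendsto_const_nhds
    -- The matrix element no longer depends on `F` once `F` contains `k` and `l`.
    filter_upwards [hle (eventually_ge_atTop ({k, l} : Finset κ))] with F hF
    rw [← inner_block, block_ofBlocks, if_pos ⟨hF (by simp), hF (by simp)⟩]
  have htr : posTrace T < ∞ := by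
    rw [posTrace_eq_tsum_of_blocks hTpos (a := fun k => (b k k : H' →L[ℂ] H')) fun k x => hTb k k x x]
    simp only [hb, hΛ.posTrace_apply (isPositive_block hA _)]
    rw [← posTrace_eq_tsum_block hA]
    exact posTrace_lt_top hA
  refine ⟨⟨T, mem_traceClass_of_isPositive hTpos htr⟩, fun k l => ?_⟩
  refine Subtype.ext (ContinuousLinearMap.ext fun y => ext_inner_left ℂ fun x => ?_)
  rw [inner_block]
  exact hTb k l x y

theorem ampliation_eq {A : traceClass (WithAncilla H κ)} {B : traceClass (WithAncilla H' κ)}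
    (h : IsAmpliation Λ A B) : ampliation Λ A = B := by
  have h1 : ∃ B, IsAmpliation Λ A B := ⟨B, h⟩
  rw [ampliation, dif_pos h1]
  exact ext_block fun k l => (h1.choose_spec k l).trans (h k l).symm

theorem IsCPTP.isAmpliation [Countable κ] (hΛ : IsCPTP Λ) {A : traceClass (WithAncilla H κ)}
    (hA : (A : WithAncilla H κ →L[ℂ] WithAncilla H κ).IsPositive) :
    IsAmpliation Λ A (ampliation Λ A) := by
  obtain ⟨B, hB⟩ := hΛ.exists_isAmpliation hA
  rwa [ampliation_eq hB]

theorem IsCPTP.isDensity_apply (hΛ : IsCPTP Λ) {ρ : traceClass H} (hρ : IsDensity ρ) :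
    IsDensity (Λ ρ) :=
  ⟨hΛ.1.isPositive_apply hρ.1, (hΛ.2 ρ).trans hρ.2⟩

theorem IsCPTP.isDensity_ampliation [Countable κ] (hΛ : IsCPTP Λ)
    {ρ : traceClass (WithAncilla H κ)} (hρ : IsDensity ρ) : IsDensity (ampliation Λ ρ) := by
  have h := hΛ.isAmpliation hρ.1
  have hpos := hΛ.1 κ _ _ h hρ.1
  refine ⟨hpos, Eq.trans ?_ hρ.2⟩
  rw [trace_eq_trace_iff hpos hρ.1, posTrace_eq_tsum_block hpos, posTrace_eq_tsum_block hρ.1]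
  exact tsum_congr fun k => (h k k) ▸ hΛ.posTrace_apply (isPositive_block hρ.1 k)

/-- A linear combination of quantum operations, applied to a linear combination of states. -/
theorem ampliation_sum [Countable κ] {ι ι' : Type*} [Fintype ι] [Fintype ι'] (c : ι → ℂ) (d : ι' → ℂ)
    {Φ : ι' → Superoperator H H'} (hΦ : ∀ j, IsCPTP (Φ j)) {ρ : ι → traceClass (WithAncilla H κ)}
    (hρ : ∀ i, IsDensity (ρ i)) :
    ampliation (∑ j, d j • Φ j) (∑ i, c i • ρ i) =
      ∑ p : ι × ι', (c p.1 * d p.2) • ampliation (Φ p.2) (ρ p.1) := by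
  -- The right-hand side has the required blocks, and by uniqueness that suffices, although `∑ d_j
  -- Φ_j` need not be completely positive.
  refine ampliation_eq fun k l => ?_
  simp only [← blockₗ_apply, map_sum, map_smul]
  simp only [blockₗ_apply, (hΦ _).isAmpliation (hρ _).1 k l, LinearMap.sum_apply,
    LinearMap.smul_apply, Finset.smul_sum, smul_smul, Fintype.sum_prod_type]

end Ampliation

/-! ### Classical simulation of a pair of states -/

section Simulation

/-- `σ = ∑ p_i ρ_i` and `τ = ∑ p_i l_i ρ_i` for states `ρ_i`, a probability vector `p` and
a likelihood ratio `l` with `∑ p_i l_i² ≤ c`. -/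
def IsSimulation {E : Type*} [NormedAddCommGroup E] [InnerProductSpace ℂ E] [CompleteSpace E]
    (c : ℝ) (σ τ : traceClass E) : Prop :=
  ∃ (ι : Type) (_ : Fintype ι) (p l : ι → ℝ) (ρ : ι → traceClass E),
    (∀ i, 0 < p i) ∧ (∀ i, 0 ≤ l i) ∧ (∀ i, IsDensity (ρ i)) ∧ ∑ i, p i = 1 ∧
    ∑ i, p i * l i = 1 ∧ ∑ i, p i * l i ^ 2 ≤ c ∧
    σ = ∑ i, (p i : ℂ) • ρ i ∧ τ = ∑ i, ((p i * l i : ℝ) : ℂ) • ρ i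

variable {H : Type*} [NormedAddCommGroup H] [InnerProductSpace ℂ H] [CompleteSpace H]
variable {H' : Type*} [NormedAddCommGroup H'] [InnerProductSpace ℂ H'] [CompleteSpace H']

theorem IsDensity.isSimulation {ρ : traceClass H} (hρ : IsDensity ρ) : IsSimulation 1 ρ ρ :=
  ⟨Unit, inferInstance, fun _ => 1, fun _ => 1, fun _ => ρ, by simp, by simp, fun _ => hρ, by simp,
    by simp, by simp, by simp, by simp⟩

theorem IsSimulation.map {c : ℝ} {σ τ : traceClass H} (h : IsSimulation c σ τ)
    {Ξ : Superoperator H H'} (hΞ : IsCPTP Ξ) : IsSimulation c (Ξ σ) (Ξ τ) := by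
  obtain ⟨ι, _, p, l, ρ, hp, hl, hρ, h1, h2, h3, rfl, rfl⟩ := h
  exact ⟨ι, inferInstance, p, l, fun i => Ξ (ρ i), hp, hl, fun i => hΞ.isDensity_apply (hρ i), h1, h2,
    h3, by simp, by simp⟩

/-- If `Λ₀ ± r⁻¹ (Λ₁ - Λ₀)` are quantum operations, one use of `Λ₀` and `Λ₁` is simulated by
one random bit with the probabilities `(1/2, 1/2)` and `((1 + r)/2, (1 - r)/2)`. -/
theorem IsSimulation.ampliation {κ : Type} [Countable κ] {c r : ℝ}
    {σ τ : traceClass (WithAncilla H κ)} (h : IsSimulation c σ τ) (hr : 0 < r) (hr1 : r ≤ 1)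
    {Λ₀ Λ₁ : Superoperator H H'} (hadd : IsCPTP (Λ₀ + ((r⁻¹ : ℝ) : ℂ) • (Λ₁ - Λ₀)))
    (hsub : IsCPTP (Λ₀ - ((r⁻¹ : ℝ) : ℂ) • (Λ₁ - Λ₀))) :
    IsSimulation (c * (1 + r ^ 2)) (ampliation Λ₀ σ) (ampliation Λ₁ τ) := by
  obtain ⟨ι, _, p, l, ρ, hp, hl, hρ, h1, h2, h3, rfl, rfl⟩ := h
  set Φ : Bool → Superoperator H H' := fun b =>
    bif b then Λ₀ + ((r⁻¹ : ℝ) : ℂ) • (Λ₁ - Λ₀) else Λ₀ - ((r⁻¹ : ℝ) : ℂ) • (Λ₁ - Λ₀)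
  have hΦ : ∀ b, IsCPTP (Φ b) := fun b => by
    cases b
    exacts [hsub, hadd]
  set s : Bool → ℝ := fun b => bif b then 1 + r else 1 - r
  have hrc : (r : ℂ) ≠ 0 := by exact_mod_cast hr.ne'
  have hΛ₀ : Λ₀ = ∑ b, (fun _ => (1 / 2 : ℂ)) b • Φ b := by
    simp only [Fintype.sum_bool, Φ, cond_true, cond_false]
    module
  have hΛ₁ : Λ₁ = ∑ b, ((s b / 2 : ℝ) : ℂ) • Φ b := by
    simp only [Fintype.sum_bool, Φ, s, cond_true, cond_false]
    push_cast
    match_scalars <;> field_simp <;> ring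
  -- The new label is the old one together with a fair bit independent of it under `p`; likelihood
  -- ratios multiply, with factors `1 ± r` for the bit.
  refine ⟨ι × Bool, inferInstance, fun q => p q.1 / 2, fun q => l q.1 * s q.2,
    fun q => QuantumEstimation.ampliation (Φ q.2) (ρ q.1), fun q => half_pos (hp _), ?_,
    fun q => (hΦ _).isDensity_ampliation (hρ _), ?_, ?_, ?_, ?_, ?_⟩
  · rintro ⟨i, b⟩
    refine mul_nonneg (hl i) ?_
    cases b <;> simp only [s, cond_true, cond_false] <;> linarith
  · simp only [Fintype.sum_prod_type, Fintype.sum_bool, add_halves, h1]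
  · simp only [Fintype.sum_prod_type, Fintype.sum_bool, s, cond_true, cond_false]
    refine Eq.trans ?_ h2
    exact Finset.sum_congr rfl fun i _ => by ring
  -- The second moment for the bit is `((1 + r)² + (1 - r)²) / 2 = 1 + r²`.
  · refine le_trans (le_of_eq ?_) (mul_le_mul_of_nonneg_right h3 (by positivity))
    simp only [Fintype.sum_prod_type, Fintype.sum_bool, s, cond_true, cond_false, Finset.sum_mul]
    exact Finset.sum_congr rfl fun i _ => by ring
  · conv_lhs => rw [hΛ₀]
    rw [ampliation_sum _ _ hΦ hρ]
    refine Finset.sum_congr rfl fun q _ => ?_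
    congr 1
    push_cast
    ring
  · conv_lhs => rw [hΛ₁]
    rw [ampliation_sum _ _ hΦ hρ]
    refine Finset.sum_congr rfl fun q _ => ?_
    congr 1
    push_cast
    ring

/-- Intermediate operations act on the states alone and leave `p` and `l` unchanged; each use of the
channel contributes one factor `1 + r²`. Adaptivity and entanglement with the ancilla therefore give
no quadratic gain. -/
theorem Estimator.isSimulation_output {m : ℕ} (e : Estimator H H' m) {r : ℝ} (hr : 0 < r)
    (hr1 : r ≤ 1) {Λ₀ Λ₁ : Superoperator H H'}
    (hadd : IsCPTP (Λ₀ + ((r⁻¹ : ℝ) : ℂ) • (Λ₁ - Λ₀)))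
    (hsub : IsCPTP (Λ₀ - ((r⁻¹ : ℝ) : ℂ) • (Λ₁ - Λ₀))) {n : ℕ} (hn : 1 ≤ n) :
    IsSimulation ((1 + r ^ 2) ^ n) (e.output (fun _ => Λ₀) n) (e.output (fun _ => Λ₁) n) := by
  have := e.countable
  obtain ⟨k, rfl⟩ := Nat.exists_eq_add_of_le' hn
  simp only [Estimator.output, Nat.add_sub_cancel]
  clear hn
  induction k with
  | zero =>
    rw [zero_add, pow_one, ← one_mul (1 + r ^ 2)]
    exact e.isDensity.isSimulation.ampliation hr hr1 hadd hsub
  | succ k ih =>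
    rw [pow_succ]
    exact (ih.map (e.isCPTP k)).ampliation hr hr1 hadd hsub

end Simulation

/-! ### Distributions of measurement outcomes -/

section Outcome

variable {Ω : Type*} [MeasurableSpace Ω]
variable {E : Type*} [NormedAddCommGroup E] [InnerProductSpace ℂ E]

theorem POVM.op_empty (M : POVM Ω E) : M.op ∅ = 0 := by
  refine ContinuousLinearMap.ext fun y => ext_inner_left ℂ fun x => ?_
  have h := M.hasSum_iUnion (fun _ => ∅) (fun _ => MeasurableSet.empty)
    (fun _ _ _ => disjoint_bot_left) x y
  simpa using tendsto_nhds_unique h.summable.tendsto_atTop_zero tendsto_const_nhds |>.symm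

/-- The measure `Δ ↦ ⟨x, M(Δ) x⟩`. -/
def POVM.vectorMeasure (M : POVM Ω E) (x : E) : Measure Ω :=
  Measure.ofMeasurable (fun Δ _ => ENNReal.ofReal (RCLike.re ⟪x, M.op Δ x⟫_ℂ))
    (by simp [M.op_empty]) (by
      intro Δ hΔ hd
      have h := (M.hasSum_iUnion Δ hΔ hd x x).mapL Complex.reCLM
      have h1 := ENNReal.ofReal_tsum_of_nonneg
        (fun k => (M.isPositive _ (hΔ k)).re_inner_nonneg_right x) h.summable
      rw [← h1]
      exact congrArg ENNReal.ofReal h.tsum_eq.symm)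

theorem POVM.vectorMeasure_apply (M : POVM Ω E) (x : E) {Δ : Set Ω} (hΔ : MeasurableSet Δ) :
    M.vectorMeasure x Δ = ENNReal.ofReal (RCLike.re ⟪x, M.op Δ x⟫_ℂ) :=
  Measure.ofMeasurable_apply Δ hΔ

variable [CompleteSpace E]

/-- From `A = ∑ |x_i⟩⟨x_i|` follows `AM = ∑ |x_i⟩⟨M x_i|`, again a nuclear sum. -/
theorem HasNuclearSum.hasSum_re_trace_comp {ι : Type*} {A M : E →L[ℂ] E} {x : ι → E}
    (h : HasNuclearSum A x x) (hM : M.IsPositive) :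
    HasSum (fun i => RCLike.re ⟪x i, M (x i)⟫_ℂ) (trace (A ∘L M)).re := by
  have hMs : ∀ v w, ⟪M v, w⟫_ℂ = ⟪v, M w⟫_ℂ := fun v w => hM.isSymmetric v w
  have h1 : HasNuclearSum (A ∘L M) x (fun i => M (x i)) := by
    refine ⟨?_, fun v => by simpa [hMs] using h.2 (M v)⟩
    refine (ENNReal.tsum_le_tsum fun i => ?_).trans_lt
      ((ENNReal.tsum_mul_left (a := ‖M‖ₑ)).trans_lt (ENNReal.mul_lt_top (by simp) h.1))
    calc ‖x i‖ₑ * ‖M (x i)‖ₑ ≤ ‖x i‖ₑ * (‖M‖ₑ * ‖x i‖ₑ) := by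
          gcongr
          exact M.le_opENorm _
      _ = ‖M‖ₑ * (‖x i‖ₑ * ‖x i‖ₑ) := by ring
  have h2 := h1.hasSum_trace.1.mapL Complex.reCLM
  simp only [hMs] at h2
  exact h2

theorem traceMul_re_nonneg {ρ : traceClass E} (hρ : (ρ : E →L[ℂ] E).IsPositive) {M : E →L[ℂ] E}
    (hM : M.IsPositive) : 0 ≤ (traceMul M ρ).re := by
  obtain ⟨x, hx⟩ := exists_hasNuclearSum_self hρ (posTrace_lt_top hρ)
  exact (hx.hasSum_re_trace_comp hM).nonneg fun i => hM.re_inner_nonneg_right (x i)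

/-- The required measure exists: for `ρ = ∑ |x_i⟩⟨x_i|` it is the sum of the measures `⟨x_i, M(·)
x_i⟩`. -/
theorem outcomeMeasure_apply {ρ : traceClass E} (hρ : (ρ : E →L[ℂ] E).IsPositive) (M : POVM Ω E)
    {Δ : Set Ω} (hΔ : MeasurableSet Δ) :
    outcomeMeasure ρ M Δ = ENNReal.ofReal (trace ((ρ : E →L[ℂ] E) ∘L M.op Δ)).re := by
  obtain ⟨x, hx⟩ := exists_hasNuclearSum_self hρ (posTrace_lt_top hρ)
  have h : ∃ μ : Measure Ω, ∀ Δ, MeasurableSet Δ →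
      μ Δ = ENNReal.ofReal (trace ((ρ : E →L[ℂ] E) ∘L M.op Δ)).re := by
    refine ⟨Measure.sum fun i => M.vectorMeasure (x i), fun Δ hΔ => ?_⟩
    have h := hx.hasSum_re_trace_comp (M.isPositive Δ hΔ)
    rw [Measure.sum_apply _ hΔ, ← h.tsum_eq, ENNReal.ofReal_tsum_of_nonneg
      (fun i => (M.isPositive Δ hΔ).re_inner_nonneg_right (x i)) h.summable]
    exact tsum_congr fun i => M.vectorMeasure_apply _ hΔ
  rw [outcomeMeasure, dif_pos h]
  exact h.choose_spec Δ hΔ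

theorem isProbabilityMeasure_outcomeMeasure {ρ : traceClass E} (hρ : IsDensity ρ) (M : POVM Ω E) :
    IsProbabilityMeasure (outcomeMeasure ρ M) := by
  refine ⟨?_⟩
  rw [outcomeMeasure_apply hρ.1 M MeasurableSet.univ, M.op_univ]
  change ENNReal.ofReal (trace (ρ : E →L[ℂ] E)).re = 1
  simp [hρ.2]

theorem isDensity_sum {ι : Type*} [Fintype ι] {p : ι → ℝ} (hp : ∀ i, 0 ≤ p i) (h1 : ∑ i, p i = 1)
    {ρ : ι → traceClass E} (hρ : ∀ i, IsDensity (ρ i)) : IsDensity (∑ i, (p i : ℂ) • ρ i) := by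
  constructor
  · rw [isPositive_iff_inner_nonneg]
    intro x
    simp only [AddSubmonoidClass.coe_finsetSum, Submodule.coe_smul, sum_apply, inner_sum]
    refine Finset.sum_nonneg fun i _ => ?_
    simp only [smul_apply, inner_smul_right]
    exact mul_nonneg (by exact_mod_cast hp i) ((hρ i).1.inner_nonneg_right x)
  · rw [← traceMul_one, map_sum]
    simp only [map_smul, traceMul_one, (hρ _).2, smul_eq_mul, mul_one]
    exact_mod_cast h1

theorem outcomeMeasure_sum {ι : Type*} [Fintype ι] {p : ι → ℝ} (hp : ∀ i, 0 ≤ p i)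
    (h1 : ∑ i, p i = 1) {ρ : ι → traceClass E} (hρ : ∀ i, IsDensity (ρ i)) (M : POVM Ω E) :
    outcomeMeasure (∑ i, (p i : ℂ) • ρ i) M =
      ∑ i, ENNReal.ofReal (p i) • outcomeMeasure (ρ i) M := by
  refine Measure.ext fun Δ hΔ => ?_
  rw [outcomeMeasure_apply (isDensity_sum hp h1 hρ).1 M hΔ]
  change ENNReal.ofReal (traceMul (M.op Δ) _).re = _
  simp only [map_sum, map_smul, smul_eq_mul, Complex.re_sum, Complex.re_ofReal_mul]
  rw [ENNReal.ofReal_sum_of_nonneg fun i _ =>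
    mul_nonneg (hp i) (traceMul_re_nonneg (hρ i).1 (M.isPositive Δ hΔ))]
  simp only [Measure.finsetSum_apply, Measure.smul_apply, outcomeMeasure_apply (hρ _).1 M hΔ,
    smul_eq_mul, ENNReal.ofReal_mul (hp _)]
  rfl

/-- The Chapman-Robbins inequality for simulated pairs of states. -/
theorem IsSimulation.sq_integral_sub_le {c : ℝ} {σ τ : traceClass E} (h : IsSimulation c σ τ)
    (M : POVM Ω E) {f : Ω → ℝ} (hf : MemLp f 2 (outcomeMeasure σ M)) :
    Integrable f (outcomeMeasure τ M) ∧
      (∫ ω, f ω ∂(outcomeMeasure τ M) - ∫ ω, f ω ∂(outcomeMeasure σ M)) ^ 2 ≤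
        (c - 1) * ∫ ω, f ω ^ 2 ∂(outcomeMeasure σ M) := by
  obtain ⟨ι, _, p, l, ρ, hp, hl, hρ, h1, h2, h3, rfl, rfl⟩ := h
  have hpl : ∀ i, 0 ≤ p i * l i := fun i => mul_nonneg (hp i).le (hl i)
  have hprob : ∀ i, IsProbabilityMeasure (outcomeMeasure (ρ i) M) :=
    fun i => isProbabilityMeasure_outcomeMeasure (hρ i) M
  rw [outcomeMeasure_sum (fun i => (hp i).le) h1 hρ] at hf ⊢
  rw [outcomeMeasure_sum hpl h2 hρ]
  have hfi : ∀ i, MemLp f 2 (outcomeMeasure (ρ i) M) := by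
    intro i
    -- Since `p_i > 0`, square integrability under the mixture passes to every component.
    have hle : ENNReal.ofReal (p i) • outcomeMeasure (ρ i) M ≤
        ∑ i, ENNReal.ofReal (p i) • outcomeMeasure (ρ i) M :=
      Finset.single_le_sum (f := fun i => ENNReal.ofReal (p i) • outcomeMeasure (ρ i) M)
        (fun _ _ => Measure.zero_le _) (Finset.mem_univ i)
    have h4 := hf.mono_measure hle
    have h5 := h4.smul_measure (c := (ENNReal.ofReal (p i))⁻¹) (by simp [hp i])
    rwa [smul_smul, ENNReal.inv_mul_cancel (by simp [hp i]) (by simp), one_smul] at h5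
  have hint : ∀ i, Integrable f (outcomeMeasure (ρ i) M) := fun i => (hfi i).integrable (by norm_num)
  have hint2 : ∀ i, Integrable (fun ω => f ω ^ 2) (outcomeMeasure (ρ i) M) :=
    fun i => (hfi i).integrable_sq
  have hs : ∀ (q : ι → ℝ) (g : Ω → ℝ), (∀ i, Integrable g (outcomeMeasure (ρ i) M)) →
      ∀ i ∈ Finset.univ, Integrable g (ENNReal.ofReal (q i) • outcomeMeasure (ρ i) M) :=
    fun q g hg i _ => (hg i).smul_measure (by simp)
  refine ⟨integrable_finsetSum_measure.2 (hs _ f hint), ?_⟩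
  rw [integral_finsetSum_measure (hs _ f hint), integral_finsetSum_measure (hs _ f hint),
    integral_finsetSum_measure (hs _ _ hint2)]
  simp only [integral_smul_measure, ENNReal.toReal_ofReal (hpl _), ENNReal.toReal_ofReal (hp _).le,
    smul_eq_mul]
  set a : ι → ℝ := fun i => ∫ ω, f ω ∂(outcomeMeasure (ρ i) M) with ha
  have hjensen : ∀ i, a i ^ 2 ≤ ∫ ω, f ω ^ 2 ∂(outcomeMeasure (ρ i) M) := by
    intro i
    have := ProbabilityTheory.variance_nonneg f (outcomeMeasure (ρ i) M)
    rw [ProbabilityTheory.variance_eq_sub (hfi i)] at this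
    simpa [ha] using this
  -- Cauchy-Schwarz with weights `p_i` separates the χ²-divergence `∑ p_i (l_i - 1)² = ∑ p_i l_i² -
  -- 1` from the second moment of the conditional means `a_i`.
  calc (∑ i, p i * l i * a i - ∑ i, p i * a i) ^ 2
      = (∑ i, (√(p i) * (l i - 1)) * (√(p i) * a i)) ^ 2 := by
        rw [← Finset.sum_sub_distrib]
        congr 1
        refine Finset.sum_congr rfl fun i _ => ?_
        have := Real.mul_self_sqrt (hp i).le
        linear_combination (-(l i - 1) * a i) * this
    _ ≤ (∑ i, (√(p i) * (l i - 1)) ^ 2) * ∑ i, (√(p i) * a i) ^ 2 :=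
        Finset.sum_mul_sq_le_sq_mul_sq _ _ _
    _ ≤ _ := by
        simp only [mul_pow, Real.sq_sqrt (hp _).le]
        have h6 : ∑ i, p i * (l i - 1) ^ 2 = ∑ i, p i * l i ^ 2 - 1 := by
          have : ∀ i, p i * (l i - 1) ^ 2 = p i * l i ^ 2 - 2 * (p i * l i) + p i := fun i => by ring
          simp only [this, Finset.sum_add_distrib, Finset.sum_sub_distrib, ← Finset.mul_sum, h1, h2]
          ring
        have h7 : 0 ≤ ∑ i, p i * (l i - 1) ^ 2 :=
          Finset.sum_nonneg fun i _ => mul_nonneg (hp i).le (sq_nonneg _)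
        refine mul_le_mul (by linarith) (Finset.sum_le_sum fun i _ =>
          mul_le_mul_of_nonneg_left (hjensen i) (hp i).le)
          (Finset.sum_nonneg fun i _ => mul_nonneg (hp i).le (sq_nonneg _)) (by linarith)

end Outcome

/-! ### Positivity along coordinate segments -/

section Segment

variable {H : Type*} [NormedAddCommGroup H] [InnerProductSpace ℂ H] [CompleteSpace H]
variable {H' : Type*} [NormedAddCommGroup H'] [InnerProductSpace ℂ H'] [CompleteSpace H']

theorem traceNorm_smul (c : ℂ) (A : H →L[ℂ] H) : traceNorm (c • A) = ‖c‖ₑ * traceNorm A := by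
  rw [traceNorm, CFC.abs_smul, traceNorm, posTrace, posTrace, ← ENNReal.tsum_mul_left]
  refine tsum_congr fun i => ?_
  have h : ⟪basis H i, (‖c‖ • CFC.abs A) (basis H i)⟫_ℂ =
      ((‖c‖ : ℝ) : ℂ) * ⟪basis H i, CFC.abs A (basis H i)⟫_ℂ := by
    rw [← inner_smul_right, Complex.coe_smul]
    rfl
  rw [h, ← ofReal_norm, ← ENNReal.ofReal_mul (norm_nonneg _)]
  simp

/-- The completely bounded norm dominates matrix elements. -/
theorem exists_enorm_inner_le_cbNorm (a : traceClass H) (x y : H') :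
    ∃ C : ℝ≥0∞, C ≠ ∞ ∧ ∀ Ψ : Superoperator H H',
      ‖⟪x, (Ψ a : H' →L[ℂ] H') y⟫_ℂ‖ₑ ≤ C * cbNorm Ψ := by
  classical
  set X : traceClass (WithAncilla H Unit) := ofBlocks {()} fun _ _ => a with hX
  have hXb : block X () () = a := by rw [hX, block_ofBlocks]; simp
  set N := traceNorm (X : WithAncilla H Unit →L[ℂ] WithAncilla H Unit) with hN
  have hNtop : N ≠ ∞ := X.2.ne
  -- The summand `1` keeps `D` nonzero, so that division by `D` is allowed below.
  set D : ℝ≥0∞ := ‖(inj () x : WithAncilla H' Unit)‖ₑ * ‖(inj () y : WithAncilla H' Unit)‖ₑ + 1 with hD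
  have hD0 : D ≠ 0 := by simp [hD]
  have hDtop : D ≠ ∞ := ENNReal.add_ne_top.2 ⟨ENNReal.mul_ne_top (by simp) (by simp), by simp⟩
  refine ⟨N * D, ENNReal.mul_ne_top hNtop hDtop, fun Ψ => ?_⟩
  -- The supremum runs over operators of trace norm one; `X` can be normalised unless it vanishes.
  rcases eq_or_ne N 0 with h0 | h0
  · have hX0 : X = 0 := by
      refine Subtype.ext (ContinuousLinearMap.ext fun v => ?_)
      have h := enorm_apply_le_traceNorm (X : WithAncilla H Unit →L[ℂ] WithAncilla H Unit) v
      rw [← hN, h0, zero_mul, nonpos_iff_eq_zero, enorm_eq_zero] at h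
      exact h
    have ha : a = 0 := by
      rw [← hXb, hX0]
      rfl
    simp [ha]
  · set c : ℂ := ((N.toReal⁻¹ : ℝ) : ℂ) with hc
    have hcN : ‖c‖ₑ * N = 1 := by
      rw [← ENNReal.ofReal_toReal hNtop, hc, ← ofReal_norm, ← ENNReal.ofReal_mul (norm_nonneg _)]
      have : N.toReal ≠ 0 := (ENNReal.toReal_pos h0 hNtop).ne'
      simp [this]
    have hnorm : traceNorm ((c • X : traceClass (WithAncilla H Unit)) :
        WithAncilla H Unit →L[ℂ] WithAncilla H Unit) = 1 := by
      rw [Submodule.coe_smul, traceNorm_smul, ← hN, hcN]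
    have hle : ‖c‖ₑ * ‖⟪x, (Ψ a : H' →L[ℂ] H') y⟫_ℂ‖ₑ ≤ D * cbNorm Ψ := by
      rw [mul_comm D, ← ENNReal.div_le_iff hD0 hDtop]
      refine le_iSup_of_le Unit (le_iSup_of_le inferInstance (le_iSup_of_le (c • X)
        (le_iSup_of_le hnorm (le_iInf fun B => le_iInf fun hB => ?_))))
      rw [ENNReal.div_le_iff hD0 hDtop]
      have h1 : block B () () = c • Ψ a := by
        rw [hB () (), block_smul, hXb, map_smul]
      have h2 := inner_block B () () x y
      rw [h1, Submodule.coe_smul, smul_apply, inner_smul_right] at h2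
      rw [← enorm_mul, h2]
      calc _ ≤ ‖(inj () x : WithAncilla H' Unit)‖ₑ *
            ‖(B : WithAncilla H' Unit →L[ℂ] WithAncilla H' Unit) (inj () y)‖ₑ := by
            simpa only [← ofReal_norm, ← ENNReal.ofReal_mul (norm_nonneg _)] using
              ENNReal.ofReal_le_ofReal (norm_inner_le_norm (𝕜 := ℂ) _ _)
        _ ≤ ‖(inj () x : WithAncilla H' Unit)‖ₑ *
            (traceNorm (B : WithAncilla H' Unit →L[ℂ] WithAncilla H' Unit) *
              ‖(inj () y : WithAncilla H' Unit)‖ₑ) := by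
            gcongr
            exact enorm_apply_le_traceNorm _ _
        _ = traceNorm (B : WithAncilla H' Unit →L[ℂ] WithAncilla H' Unit) *
            (‖(inj () x : WithAncilla H' Unit)‖ₑ * ‖(inj () y : WithAncilla H' Unit)‖ₑ) := by ring
        _ ≤ _ := by
            gcongr
            exact le_self_add
    calc ‖⟪x, (Ψ a : H' →L[ℂ] H') y⟫_ℂ‖ₑ = N * (‖c‖ₑ * ‖⟪x, (Ψ a : H' →L[ℂ] H') y⟫_ℂ‖ₑ) := by
          rw [← mul_assoc, mul_comm N, hcN, one_mul]
      _ ≤ N * (D * cbNorm Ψ) := by gcongr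
      _ = N * D * cbNorm Ψ := by ring

/-- Matrix elements are continuous for the completely bounded norm, so differentiability in that
norm descends to scalar functions on the coordinate line. -/
theorem HasPartialDerivAt.hasDerivAt_inner {m : ℕ} {Λ : Param m → Superoperator H H'} {i : Fin m}
    {D : Superoperator H H'} {θ : Param m} {s : ℝ}
    (h : HasPartialDerivAt Λ i D (θ + s • EuclideanSpace.single i (1 : ℝ)))
    (a : traceClass H) (x y : H') :
    HasDerivAt (fun t : ℝ => ⟪x, (Λ (θ + t • EuclideanSpace.single i (1 : ℝ)) a : H' →L[ℂ] H') y⟫_ℂ)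
      ⟪x, (D a : H' →L[ℂ] H') y⟫_ℂ s := by
  obtain ⟨C, hC, hle⟩ := exists_enorm_inner_le_cbNorm (H := H) a x y
  rw [hasDerivAt_iff_tendsto_slope_zero, tendsto_iff_edist_tendsto_0]
  have h1 := ENNReal.Tendsto.const_mul h (Or.inr hC)
  rw [mul_zero] at h1
  refine tendsto_of_tendsto_of_tendsto_of_le_of_le tendsto_const_nhds h1 (fun _ => zero_le) fun t => ?_
  refine le_of_eq_of_le ?_ (hle _)
  rw [edist_eq_enorm_sub]
  congr 1
  have h2 : θ + (s + t) • EuclideanSpace.single i (1 : ℝ) =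
      θ + s • EuclideanSpace.single i (1 : ℝ) + t • EuclideanSpace.single i (1 : ℝ) := by module
  simp only [h2, LinearMap.sub_apply, LinearMap.smul_apply, Submodule.coe_sub, Submodule.coe_smul,
    sub_apply, smul_apply, inner_sub_right, inner_smul_right, Complex.real_smul]

/-- Grönwall's inequality for `|u'| ≤ u / δ`. -/
theorem abs_sub_le_of_abs_deriv_le {u u' : ℝ → ℝ} {t δ : ℝ} (ht : 0 ≤ t) (hδ : 0 < δ) (htδ : t ≤ δ)
    (hu : ∀ s ∈ Set.Icc 0 t, HasDerivAt u (u' s) s) (hadd : ∀ s ∈ Set.Icc 0 t, 0 ≤ u s + δ * u' s)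
    (hsub : ∀ s ∈ Set.Icc 0 t, 0 ≤ u s - δ * u' s) : |u t - u 0| ≤ 2 * t / δ * u 0 := by
  have h0 : (0 : ℝ) ∈ Set.Icc 0 t := ⟨le_rfl, ht⟩
  have ht' : t ∈ Set.Icc 0 t := ⟨ht, le_rfl⟩
  have hu0 : 0 ≤ u 0 := by linarith [hadd 0 h0, hsub 0 h0]
  -- For `c = 1/δ` this derivative is nonnegative, for `c = -1/δ` nonpositive; so `exp(-t/δ) u(0) ≤
  -- u(t) ≤ exp(t/δ) u(0)`.
  have hd : ∀ c : ℝ, ∀ s ∈ Set.Icc 0 t, HasDerivAt (fun s => Real.exp (c * s) * u s)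
      (Real.exp (c * s) * (c * u s + u' s)) s := by
    intro c s hs
    have h1 := (((hasDerivAt_id' s).const_mul c).exp).fun_mul (hu s hs)
    refine h1.congr_deriv ?_
    ring
  have hint : ∀ s ∈ interior (Set.Icc 0 t), s ∈ Set.Icc 0 t := fun s hs => interior_subset hs
  have hmono : MonotoneOn (fun s => Real.exp (δ⁻¹ * s) * u s) (Set.Icc 0 t) := by
    refine monotoneOn_of_deriv_nonneg (convex_Icc 0 t)
      (fun s hs => (hd _ s hs).continuousAt.continuousWithinAt)
      (fun s hs => (hd _ s (hint s hs)).differentiableAt.differentiableWithinAt) fun s hs => ?_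
    rw [(hd _ s (hint s hs)).deriv]
    refine mul_nonneg (Real.exp_pos _).le ?_
    have := mul_nonneg (inv_pos.2 hδ).le (hadd s (hint s hs))
    rwa [mul_add, inv_mul_cancel_left₀ hδ.ne'] at this
  have hanti : AntitoneOn (fun s => Real.exp (-δ⁻¹ * s) * u s) (Set.Icc 0 t) := by
    refine antitoneOn_of_deriv_nonpos (convex_Icc 0 t)
      (fun s hs => (hd _ s hs).continuousAt.continuousWithinAt)
      (fun s hs => (hd _ s (hint s hs)).differentiableAt.differentiableWithinAt) fun s hs => ?_
    rw [(hd _ s (hint s hs)).deriv]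
    refine mul_nonpos_of_nonneg_of_nonpos (Real.exp_pos _).le ?_
    have := mul_nonneg (inv_pos.2 hδ).le (hsub s (hint s hs))
    rw [mul_sub, inv_mul_cancel_left₀ hδ.ne'] at this
    linarith
  have h1 := hmono h0 ht' ht
  have h2 := hanti h0 ht' ht
  simp only [mul_zero, Real.exp_zero, one_mul] at h1 h2
  have hx : |δ⁻¹ * t| ≤ 1 := by
    rw [abs_of_nonneg (by positivity), inv_mul_le_iff₀ hδ, mul_one]
    exact htδ
  -- The factor `2` in the conclusion comes from `|exp x - 1| ≤ 2|x|` for `|x| ≤ 1`, which is where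
  -- `t ≤ δ` enters.
  have h3 := (abs_le.1 (Real.abs_exp_sub_one_le hx)).2
  rw [abs_of_nonneg (by positivity)] at h3
  have h4 := Real.add_one_le_exp (-(δ⁻¹ * t))
  have h5 : u t ≤ Real.exp (δ⁻¹ * t) * u 0 := by
    have := mul_le_mul_of_nonneg_left h2 (Real.exp_pos (δ⁻¹ * t)).le
    rwa [← mul_assoc, ← Real.exp_add, neg_mul, add_neg_cancel, Real.exp_zero, one_mul] at this
  have h6 : Real.exp (-(δ⁻¹ * t)) * u 0 ≤ u t := by
    have := mul_le_mul_of_nonneg_left h1 (Real.exp_pos (-(δ⁻¹ * t))).le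
    rwa [← mul_assoc, ← Real.exp_add, neg_add_cancel, Real.exp_zero, one_mul] at this
  have h7 : 2 * t / δ = 2 * (δ⁻¹ * t) := by ring
  have h8 : 0 ≤ δ⁻¹ * t := by positivity
  rw [h7, abs_le]
  constructor <;> nlinarith

/-- Trace preservation is an affine condition, so on the line through two quantum operations only
complete positivity is at stake. -/
theorem IsCPTP.of_trace {Λ Ψ : Superoperator H H'} {c : ℂ} {Λ' : Superoperator H H'} (hΛ : IsCPTP Λ)
    (hΛ' : IsCPTP Λ') (hΨ : Ψ = Λ + c • (Λ' - Λ)) (h : IsCompletelyPositive Ψ) : IsCPTP Ψ := by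
  refine ⟨h, fun A => ?_⟩
  rw [hΨ, ← traceMul_one]
  simp only [LinearMap.add_apply, LinearMap.smul_apply, LinearMap.sub_apply, map_add, map_smul,
    map_sub, traceMul_one, hΛ.2, hΛ'.2, sub_self, smul_zero, add_zero]

/-- The infinitesimal hypothesis becomes a finite one: Grönwall's inequality is applied to each
block sum `∑ ⟨x_k, Λ(A_kl) x_l⟩` with `A ≥ 0` along the segment, and the resulting bound has the
same constant `2t/δ` for all of them. -/
theorem isCPTP_add_sub {m : ℕ} {i : Fin m} {Λ dΛ : Param m → Superoperator H H'} {θ : Param m}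
    {δ t : ℝ} (hδ : 0 < δ) (ht : 0 < t) (htδ : t ≤ δ)
    (hΛ : ∀ s ∈ Set.Icc 0 t, IsCPTP (Λ (θ + s • EuclideanSpace.single i (1 : ℝ))))
    (hderiv : ∀ s ∈ Set.Icc 0 t, HasPartialDerivAt Λ i (dΛ (θ + s • EuclideanSpace.single i (1 : ℝ)))
      (θ + s • EuclideanSpace.single i (1 : ℝ)))
    (hadd : ∀ s ∈ Set.Icc 0 t, IsCompletelyPositive (Λ (θ + s • EuclideanSpace.single i (1 : ℝ)) +
      (δ : ℂ) • dΛ (θ + s • EuclideanSpace.single i (1 : ℝ))))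
    (hsub : ∀ s ∈ Set.Icc 0 t, IsCompletelyPositive (Λ (θ + s • EuclideanSpace.single i (1 : ℝ)) -
      (δ : ℂ) • dΛ (θ + s • EuclideanSpace.single i (1 : ℝ)))) :
    IsCPTP (Λ θ + (((2 * t / δ)⁻¹ : ℝ) : ℂ) •
        (Λ (θ + t • EuclideanSpace.single i (1 : ℝ)) - Λ θ)) ∧
      IsCPTP (Λ θ - (((2 * t / δ)⁻¹ : ℝ) : ℂ) •
        (Λ (θ + t • EuclideanSpace.single i (1 : ℝ)) - Λ θ)) := by
  have h0 : (0 : ℝ) ∈ Set.Icc 0 t := ⟨le_rfl, ht.le⟩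
  have ht' : t ∈ Set.Icc 0 t := ⟨ht.le, le_rfl⟩
  have hΛ0 : IsCPTP (Λ θ) := by simpa using hΛ 0 h0
  have hr : 0 < 2 * t / δ := by positivity
  have key : ∀ (κ : Type) [Countable κ] (A : traceClass (WithAncilla H κ)),
      (A : WithAncilla H κ →L[ℂ] WithAncilla H κ).IsPositive → ∀ (F : Finset κ) (x : κ → H'),
      ∃ u₀ u₁ : ℝ, |u₁ - u₀| ≤ 2 * t / δ * u₀ ∧
        ∑ k ∈ F, ∑ l ∈ F, ⟪x k, (Λ θ (block A k l) : H' →L[ℂ] H') (x l)⟫_ℂ = (u₀ : ℂ) ∧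
        ∑ k ∈ F, ∑ l ∈ F, ⟪x k, (Λ (θ + t • EuclideanSpace.single i (1 : ℝ)) (block A k l) :
          H' →L[ℂ] H') (x l)⟫_ℂ = (u₁ : ℂ) := by
    intro κ _ A hA F x
    set φ : Superoperator H H' → ℂ := fun Ψ =>
      ∑ k ∈ F, ∑ l ∈ F, ⟪x k, (Ψ (block A k l) : H' →L[ℂ] H') (x l)⟫_ℂ with hφ
    have hφadd : ∀ Ψ Ψ', φ (Ψ + Ψ') = φ Ψ + φ Ψ' := by
      intro Ψ Ψ'
      simp [hφ, Finset.sum_add_distrib]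
    have hφsmul : ∀ (c : ℂ) Ψ, φ (c • Ψ) = c * φ Ψ := by
      intro c Ψ
      simp [hφ, Finset.mul_sum]
    have hφpos : ∀ Ψ, IsCompletelyPositive Ψ → 0 ≤ φ Ψ := fun Ψ h => h.sum_inner_nonneg hA F x
    have hreal : ∀ Ψ, IsCompletelyPositive Ψ → φ Ψ = ((φ Ψ).re : ℂ) :=
      fun Ψ h => Complex.ext rfl (Complex.nonneg_iff.1 (hφpos Ψ h)).2.symm
    refine ⟨(φ (Λ θ)).re, (φ (Λ (θ + t • EuclideanSpace.single i (1 : ℝ)))).re, ?_,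
      hreal _ hΛ0.1, hreal _ (hΛ t ht').1⟩
    have h1 := abs_sub_le_of_abs_deriv_le
      (u := fun s => (φ (Λ (θ + s • EuclideanSpace.single i (1 : ℝ)))).re)
      (u' := fun s => (φ (dΛ (θ + s • EuclideanSpace.single i (1 : ℝ)))).re) ht.le hδ htδ ?_ ?_ ?_
    · simpa using h1
    · intro s hs
      have h2 : HasDerivAt (fun s : ℝ => φ (Λ (θ + s • EuclideanSpace.single i (1 : ℝ))))
          (φ (dΛ (θ + s • EuclideanSpace.single i (1 : ℝ)))) s :=
        HasDerivAt.fun_sum fun k _ => HasDerivAt.fun_sum fun l _ =>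
          (hderiv s hs).hasDerivAt_inner _ _ _
      exact Complex.reCLM.hasFDerivAt.comp_hasDerivAt s h2
    · intro s hs
      have h3 := (Complex.nonneg_iff.1 (hφpos _ (hadd s hs))).1
      rwa [hφadd, hφsmul, Complex.add_re, Complex.re_ofReal_mul] at h3
    · intro s hs
      have h3 := (Complex.nonneg_iff.1 (hφpos _ (hsub s hs))).1
      have h4 : Λ (θ + s • EuclideanSpace.single i (1 : ℝ)) -
          (δ : ℂ) • dΛ (θ + s • EuclideanSpace.single i (1 : ℝ)) =
            Λ (θ + s • EuclideanSpace.single i (1 : ℝ)) +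
              ((-δ : ℝ) : ℂ) • dΛ (θ + s • EuclideanSpace.single i (1 : ℝ)) := by
        rw [Complex.ofReal_neg]
        module
      rw [h4, hφadd, hφsmul, Complex.add_re, Complex.re_ofReal_mul] at h3
      linarith
  have main : ∀ ε : ℝ, |ε| = 1 → IsCompletelyPositive (Λ θ + ((ε * (2 * t / δ)⁻¹ : ℝ) : ℂ) •
      (Λ (θ + t • EuclideanSpace.single i (1 : ℝ)) - Λ θ)) := by
    intro ε hε
    refine isCompletelyPositive_of_sum_inner_nonneg fun κ _ A hA F x => ?_
    obtain ⟨u₀, u₁, hle, h1, h2⟩ := key κ A hA F x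
    have h3 : ∑ k ∈ F, ∑ l ∈ F, ⟪x k, ((Λ θ + ((ε * (2 * t / δ)⁻¹ : ℝ) : ℂ) •
        (Λ (θ + t • EuclideanSpace.single i (1 : ℝ)) - Λ θ)) (block A k l) :
          H' →L[ℂ] H') (x l)⟫_ℂ = ((u₀ + (ε * (2 * t / δ)⁻¹) * (u₁ - u₀) : ℝ) : ℂ) := by
      push_cast
      rw [← h1, ← h2]
      simp only [LinearMap.add_apply, LinearMap.smul_apply, LinearMap.sub_apply, Submodule.coe_add,
        Submodule.coe_smul, Submodule.coe_sub, add_apply, smul_apply, sub_apply, inner_add_right,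
        inner_smul_right, inner_sub_right, Finset.sum_add_distrib, ← Finset.mul_sum,
        Finset.sum_sub_distrib]
    rw [h3, Complex.zero_le_real]
    have h4 : |ε * (2 * t / δ)⁻¹ * (u₁ - u₀)| ≤ u₀ := by
      rw [abs_mul, abs_mul, hε, one_mul, abs_of_pos (inv_pos.2 hr), inv_mul_le_iff₀ hr]
      exact hle
    linarith [(abs_le.1 h4).1]
  have hadd' := main 1 (by simp)
  have hsub' := main (-1) (by simp)
  rw [one_mul] at hadd'
  have hneg : Λ θ - (((2 * t / δ)⁻¹ : ℝ) : ℂ) •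
      (Λ (θ + t • EuclideanSpace.single i (1 : ℝ)) - Λ θ) =
        Λ θ + ((-1 * (2 * t / δ)⁻¹ : ℝ) : ℂ) •
          (Λ (θ + t • EuclideanSpace.single i (1 : ℝ)) - Λ θ) := by
    rw [neg_one_mul, Complex.ofReal_neg]
    module
  exact ⟨hΛ0.of_trace (hΛ t ht') rfl hadd', hΛ0.of_trace (hΛ t ht') hneg (hneg ▸ hsub')⟩

end Segment

/-! ### The Cramér-Rao bound -/

section CramerRao

variable {H : Type*} [NormedAddCommGroup H] [InnerProductSpace ℂ H] [CompleteSpace H]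
variable {H' : Type*} [NormedAddCommGroup H'] [InnerProductSpace ℂ H'] [CompleteSpace H']
variable {m : ℕ}

/-- This is where linearity in `n` appears: `(1 + r²)^n ≤ exp(n r²)`, and the exponential is
linearised near `0`. -/
theorem one_add_sq_pow_sub_one_le {r : ℝ} {n : ℕ} (h : n * r ^ 2 ≤ 1) :
    (1 + r ^ 2) ^ n - 1 ≤ 2 * (n * r ^ 2) := by
  have h1 : (1 + r ^ 2) ^ n ≤ Real.exp (n * r ^ 2) := by
    rw [Real.exp_nat_mul]
    gcongr
    linarith [Real.add_one_le_exp (r ^ 2)]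
  have h2 := (abs_le.1 (Real.abs_exp_sub_one_le (x := n * r ^ 2)
    (by rwa [abs_of_nonneg (by positivity)]))).2
  rw [abs_of_nonneg (by positivity)] at h2
  linarith

theorem memLp_two_of_lintegral {α F : Type*} [MeasurableSpace α] [NormedAddCommGroup F]
    {μ : Measure α} {f : α → F} (hf : AEStronglyMeasurable f μ) (h : ∫⁻ a, ‖f a‖ₑ ^ 2 ∂μ < ∞) :
    MemLp f 2 μ := by
  refine ⟨hf, ?_⟩
  rw [eLpNorm_lt_top_iff_lintegral_rpow_enorm_lt_top (by norm_num) (by norm_num)]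
  simpa using h

theorem Estimator.isDensity_output (e : Estimator H H' m) {Λ : Superoperator H H'} (hΛ : IsCPTP Λ)
    (n : ℕ) : IsDensity (e.output (fun _ => Λ) n) := by
  have := e.countable
  unfold Estimator.output
  induction n - 1 with
  | zero => exact hΛ.isDensity_ampliation e.isDensity
  | succ k ih => exact hΛ.isDensity_ampliation ((e.isCPTP k).isDensity_apply ih)

theorem Estimator.isProbabilityMeasure_law (e : Estimator H H' m) {Λ : Superoperator H H'}
    (hΛ : IsCPTP Λ) (n : ℕ) : IsProbabilityMeasure (e.law Λ n) :=
  isProbabilityMeasure_outcomeMeasure (e.isDensity_output hΛ n) e.M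

/-- The Cramér-Rao bound: if `Λ ± δ ∂_j Λ` is completely positive on `Θ`, then
`(∂_j E[w · T])² ≤ (8 n / δ²) E[(w · (T - θ))²]`. -/
theorem Estimator.sq_deriv_le (e : Estimator H H' m) {Λ dΛ : Param m → Superoperator H H'}
    {Θ : Set (Param m)} (hΘ : IsOpen Θ) {θ : Param m} (hθ : θ ∈ Θ) {j : Fin m} {δ : ℝ} (hδ : 0 < δ)
    (hΛ : ∀ θ ∈ Θ, IsCPTP (Λ θ)) (hderiv : ∀ θ ∈ Θ, HasPartialDerivAt Λ j (dΛ θ) θ)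
    (hadd : ∀ θ ∈ Θ, IsCompletelyPositive (Λ θ + (δ : ℂ) • dΛ θ))
    (hsub : ∀ θ ∈ Θ, IsCompletelyPositive (Λ θ - (δ : ℂ) • dΛ θ)) {n : ℕ} (hn : 1 ≤ n)
    (hT : MemLp (fun ω => e.T ω - θ) 2 (e.law (Λ θ) n)) {b : Fin m → ℝ}
    (hb : ∀ i, HasLineDerivAt ℝ (fun θ' => e.expectation (Λ θ') n i) (b i) θ
      (EuclideanSpace.single j (1 : ℝ))) (w : Fin m → ℝ) :
    (∑ i, w i * b i) ^ 2 ≤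
      8 * n / δ ^ 2 * ∫ ω, (∑ i, w i * (e.T ω i - θ i)) ^ 2 ∂(e.law (Λ θ) n) := by
  set v : Param m := EuclideanSpace.single j (1 : ℝ) with hv
  set V := ∫ ω, (∑ i, w i * (e.T ω i - θ i)) ^ 2 ∂(e.law (Λ θ) n) with hV
  set g : ℝ → ℝ := fun t => ∑ i, w i * e.expectation (Λ (θ + t • v)) n i with hg
  have hgd : HasDerivAt g (∑ i, w i * b i) 0 :=
    HasDerivAt.fun_sum fun i _ => (hb i).const_mul (w i)
  have hcoord : ∀ i, MemLp (fun ω => e.T ω i - θ i) 2 (e.law (Λ θ) n) :=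
    fun i => MemLp.eval_piLp hT i
  have hf : MemLp (fun ω => ∑ i, w i * (e.T ω i - θ i)) 2 (e.law (Λ θ) n) :=
    memLp_finsetSum _ fun i _ => (hcoord i).const_mul (w i)
  have hseg : ∀ᶠ t in 𝓝[>] (0 : ℝ), ∀ s ∈ Set.Icc 0 t, θ + s • v ∈ Θ := by
    have hcont : Continuous fun s : ℝ => θ + s • v := by fun_prop
    obtain ⟨η, hη, hball⟩ := Metric.isOpen_iff.1 (hΘ.preimage hcont) 0 (by simpa using hθ)
    filter_upwards [Ioo_mem_nhdsGT hη] with t ht s hs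
    exact hball (by simpa [abs_of_nonneg hs.1] using hs.2.trans_lt ht.2)
  have hbound : ∀ᶠ t in 𝓝[>] (0 : ℝ), (t⁻¹ • (g (0 + t) - g 0)) ^ 2 ≤ 8 * n / δ ^ 2 * V := by
    -- Here `n` is fixed while `t → 0`, so the divergence of the `n` bits may be linearised.
    have hsmall : ∀ᶠ t in 𝓝[>] (0 : ℝ), n * (2 * t / δ) ^ 2 < 1 := by
      have : Tendsto (fun t : ℝ => n * (2 * t / δ) ^ 2) (𝓝[>] 0) (𝓝 (n * (2 * 0 / δ) ^ 2)) :=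
        (Continuous.tendsto (by fun_prop) 0).mono_left nhdsWithin_le_nhds
      exact this.eventually_lt_const (by simp)
    filter_upwards [hseg, hsmall, Ioo_mem_nhdsGT (half_pos hδ)] with t hts htn ht
    have hr : 0 < 2 * t / δ := by have := ht.1; positivity
    have hr1 : 2 * t / δ ≤ 1 := by rw [div_le_one hδ]; linarith [ht.2]
    obtain ⟨h1, h2⟩ := isCPTP_add_sub hδ ht.1 (by linarith [ht.2]) (fun s hs => hΛ _ (hts s hs))
      (fun s hs => hderiv _ (hts s hs)) (fun s hs => hadd _ (hts s hs))
      (fun s hs => hsub _ (hts s hs))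
    have hsim := e.isSimulation_output hr hr1 h1 h2 hn
    -- The centring stays at `θ` while the law varies, so it cancels in the difference of the two
    -- means.
    have hexp : ∀ θ' ∈ Θ, (∀ i, Integrable (fun ω => e.T ω i - θ i) (e.law (Λ θ') n)) →
        ∫ ω, ∑ i, w i * (e.T ω i - θ i) ∂(e.law (Λ θ') n) =
          ∑ i, w i * e.expectation (Λ θ') n i - ∑ i, w i * θ i := by
      intro θ' hθ' hint
      have hprob : IsProbabilityMeasure (e.law (Λ θ') n) := e.isProbabilityMeasure_law (hΛ θ' hθ') n
      have hint' : ∀ i, Integrable (fun ω => e.T ω i) (e.law (Λ θ') n) := fun i => by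
        exact ((hint i).add (integrable_const (θ i))).congr
          (Filter.Eventually.of_forall fun ω => sub_add_cancel _ _)
      rw [integral_finsetSum _ fun i _ => (hint i).const_mul (w i), ← Finset.sum_sub_distrib]
      refine Finset.sum_congr rfl fun i _ => ?_
      rw [integral_const_mul, integral_sub (hint' i) (integrable_const _), Estimator.expectation,
        eval_integral_piLp hint']
      simp [mul_sub]
    have h3 := (hsim.sq_integral_sub_le e.M hf).2
    have h4 := hexp (θ + t • v) (hts t ⟨ht.1.le, le_rfl⟩)
      fun i => (hsim.sq_integral_sub_le e.M (hcoord i)).1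
    have hprob0 : IsProbabilityMeasure (e.law (Λ θ) n) := e.isProbabilityMeasure_law (hΛ θ hθ) n
    have h5 := hexp θ hθ fun i => (hcoord i).integrable (by norm_num)
    change (∫ ω, ∑ i, w i * (e.T ω i - θ i) ∂(e.law (Λ (θ + t • v)) n) -
      ∫ ω, ∑ i, w i * (e.T ω i - θ i) ∂(e.law (Λ θ) n)) ^ 2 ≤ _ * V at h3
    have h6 : g (0 + t) - g 0 = ∫ ω, ∑ i, w i * (e.T ω i - θ i) ∂(e.law (Λ (θ + t • v)) n) -
        ∫ ω, ∑ i, w i * (e.T ω i - θ i) ∂(e.law (Λ θ) n) := by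
      rw [h4, h5]
      simp [hg]
    have hV0 : 0 ≤ V := integral_nonneg fun ω => sq_nonneg _
    rw [smul_eq_mul, mul_pow, h6, inv_pow, inv_mul_le_iff₀ (pow_pos ht.1 2)]
    -- The constant: `2 n r² = 8 n t² / δ²` for `r = 2t/δ`, and `t²` cancels against the squared
    -- difference quotient.
    refine h3.trans ((mul_le_mul_of_nonneg_right (one_add_sq_pow_sub_one_le htn.le) hV0).trans_eq ?_)
    field_simp
    ring
  -- The derivative exists by assumption, so the limit from the right determines it.
  have hlim := (hasDerivAt_iff_tendsto_slope_zero.1 hgd).mono_left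
    (nhdsGT_le_nhdsNE 0)
  exact le_of_tendsto (hlim.pow 2) hbound

theorem Estimator.memLp_sub (e : Estimator H H' m) {Λ : Superoperator H H'} {θ : Param m} {n : ℕ}
    {a₄ : ℝ≥0} (h : ∫⁻ ω, ‖e.T ω - θ‖ₑ ^ 2 ∂(e.law Λ n) ≤ n * (a₄ : ℝ≥0∞) ^ 2) :
    MemLp (fun ω => e.T ω - θ) 2 (e.law Λ n) :=
  memLp_two_of_lintegral (e.measurable.sub_const θ).aestronglyMeasurable
    (h.trans_lt (ENNReal.mul_lt_top (by simp) (by simp)))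

/-- The right-hand side is the sum over all rows of `C` of such second moments; one of them is kept.
-/
theorem Estimator.integral_sq_le_trace_mul_mse (e : Estimator H H' m) {Λ : Superoperator H H'}
    {θ : Param m} {n : ℕ} (hT : MemLp (fun ω => e.T ω - θ) 2 (e.law Λ n))
    (C : Matrix (Fin m) (Fin m) ℝ) (a : Fin m) :
    ∫ ω, (∑ i, C a i * (e.T ω i - θ i)) ^ 2 ∂(e.law Λ n) ≤
      (C.conjTranspose * C * e.mse Λ θ n).trace := by
  have hcoord : ∀ i, MemLp (fun ω => e.T ω i - θ i) 2 (e.law Λ n) := fun i => MemLp.eval_piLp hT i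
  have hint : ∀ i k, Integrable (fun ω => (e.T ω i - θ i) * (e.T ω k - θ k)) (e.law Λ n) :=
    fun i k => (hcoord i).integrable_mul (hcoord k)
  have h1 : ∀ a, ∫ ω, (∑ i, C a i * (e.T ω i - θ i)) ^ 2 ∂(e.law Λ n) =
      ∑ i, ∑ k, C a i * C a k * e.mse Λ θ n i k := by
    intro a
    have h2 : ∀ ω, (∑ i, C a i * (e.T ω i - θ i)) ^ 2 =
        ∑ i, ∑ k, C a i * C a k * ((e.T ω i - θ i) * (e.T ω k - θ k)) := by
      intro ω
      rw [sq, Finset.sum_mul_sum]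
      exact Finset.sum_congr rfl fun i _ => Finset.sum_congr rfl fun k _ => by ring
    simp only [h2]
    rw [integral_finsetSum _ fun i _ => integrable_finsetSum _ fun k _ => (hint i k).const_mul _]
    refine Finset.sum_congr rfl fun i _ => ?_
    rw [integral_finsetSum _ fun k _ => (hint i k).const_mul _]
    exact Finset.sum_congr rfl fun k _ => integral_const_mul _ _
  have h3 : (C.conjTranspose * C * e.mse Λ θ n).trace =
      ∑ a, ∫ ω, (∑ i, C a i * (e.T ω i - θ i)) ^ 2 ∂(e.law Λ n) := by
    simp only [h1, Matrix.trace, Matrix.diag, Matrix.mul_apply, Matrix.conjTranspose_apply, star_trivial,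
      Finset.sum_mul]
    calc _ = ∑ i, ∑ a, ∑ k, C a i * C a k * e.mse Λ θ n k i :=
          Finset.sum_congr rfl fun i _ => Finset.sum_comm
      _ = ∑ a, ∑ i, ∑ k, C a i * C a k * e.mse Λ θ n k i := Finset.sum_comm
      _ = _ := by
          refine Finset.sum_congr rfl fun a _ => ?_
          rw [Finset.sum_comm]
          exact Finset.sum_congr rfl fun i _ => Finset.sum_congr rfl fun k _ => by ring
  rw [h3]
  exact Finset.single_le_sum (f := fun a => ∫ ω, (∑ i, C a i * (e.T ω i - θ i)) ^ 2 ∂(e.law Λ n))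
    (fun _ _ => integral_nonneg fun ω => sq_nonneg _) (Finset.mem_univ a)

open scoped MatrixOrder in
/-- A lower bound for `n Tr G MSE` that is uniform over the admissible sequences. -/
theorem exists_pos_le_trace_mul_mse {Θ : Set (Param m)} (hΘ : IsOpen Θ)
    {Λ : Param m → Superoperator H H'} (hΛ : ∀ θ ∈ Θ, IsCPTP (Λ θ))
    {dΛ : Fin m → Param m → Superoperator H H'} {a₁ : ℝ≥0}
    (hderiv : ∀ i, ∀ θ ∈ Θ, HasPartialDerivAt Λ i (dΛ i θ) θ)
    (hint : ∃ ε > 0, ∀ u : Param m, ‖u‖ < ε → ∀ θ ∈ Θ,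
      IsCompletelyPositive (Λ θ + ∑ i, ((u i : ℝ) : ℂ) • dΛ i θ))
    {θ : Param m} (hθ : θ ∈ Θ) {G : Matrix (Fin m) (Fin m) ℝ} (hG : G.PosSemidef) (hG0 : G ≠ 0) :
    ∃ c > 0, ∀ e : ℕ → Estimator H H' m, Admissible Θ Λ dΛ a₁ e →
      ∀ᶠ n : ℕ in atTop, c ≤ n * (G * (e n).mse (Λ θ) θ n).trace := by
  obtain ⟨C, rfl⟩ : ∃ C : Matrix (Fin m) (Fin m) ℝ, G = C.conjTranspose * C :=
    CStarAlgebra.nonneg_iff_eq_star_mul_self.1 hG.nonneg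
  obtain ⟨a, j, hC⟩ : ∃ a j, C a j ≠ 0 := by
    by_contra! h
    exact hG0 (by rw [show C = 0 from Matrix.ext h, Matrix.mul_zero])
  obtain ⟨ε, hε, hpos⟩ := hint
  -- The hypothesis covers the open ball of radius `ε`; `δ = ε/2` puts both `δ e_j` and `-δ e_j`
  -- inside.
  have hδ : 0 < ε / 2 := half_pos hε
  have hcp : ∀ s : ℝ, |s| < ε → ∀ θ ∈ Θ, IsCompletelyPositive (Λ θ + (s : ℂ) • dΛ j θ) := by
    intro s hs θ hθ
    have h := hpos (EuclideanSpace.single j s) (by simpa using hs) θ hθ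
    have h1 : ∑ i, ((EuclideanSpace.single j s i : ℝ) : ℂ) • dΛ i θ = (s : ℂ) • dΛ j θ := by
      rw [Finset.sum_eq_single j]
      · simp
      · intro i _ hi
        simp [hi]
      · simp
    rwa [h1] at h
  have hadd := hcp (ε / 2) (by rw [abs_of_pos hδ]; linarith)
  have hsub : ∀ θ ∈ Θ, IsCompletelyPositive (Λ θ - ((ε / 2 : ℝ) : ℂ) • dΛ j θ) := by
    intro θ hθ
    have h := hcp (-(ε / 2)) (by rw [abs_neg, abs_of_pos hδ]; linarith) θ hθ
    have h1 : Λ θ - ((ε / 2 : ℝ) : ℂ) • dΛ j θ = Λ θ + ((-(ε / 2) : ℝ) : ℂ) • dΛ j θ := by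
      rw [Complex.ofReal_neg]
      module
    rwa [h1]
  -- The factor `δ²/8` is the Cramér-Rao constant; `C_aj²/2` is half the limit of the squared
  -- derivative, hence eventually exceeded by it.
  refine ⟨(ε / 2) ^ 2 / 8 * (C a j ^ 2 / 2), by positivity, fun e he => ?_⟩
  obtain ⟨-, B, hB, hBlim⟩ := he.1 θ hθ
  obtain ⟨S, -, hS⟩ := he.2
  -- The weights are row `a` of `C`; since the derivative matrix tends to the identity, only the
  -- entry `C_aj` survives.
  have hlim : Tendsto (fun n => (∑ i, C a i * B n i j) ^ 2) atTop (𝓝 (C a j ^ 2)) := by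
    have h : Tendsto (fun n => (∑ i, C a i * B n i j) ^ 2) atTop
        (𝓝 ((∑ i, C a i * (1 : Matrix (Fin m) (Fin m) ℝ) i j) ^ 2)) :=
      (tendsto_finsetSum _ fun i _ =>
        (tendsto_pi_nhds.1 (tendsto_pi_nhds.1 hBlim i) j).const_mul _).pow 2
    simpa [Matrix.one_apply] using h
  have hlt : C a j ^ 2 / 2 < C a j ^ 2 := half_lt_self (by positivity)
  filter_upwards [eventually_ge_atTop 1, hlim.eventually_const_lt hlt] with n hn hBn
  obtain ⟨a₄, ha₄⟩ := hS n hn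
  have hT := (e n).memLp_sub (ha₄ θ hθ).2
  have h1 := (e n).sq_deriv_le hΘ hθ hδ hΛ (hderiv j) hadd hsub hn hT (fun i => hB n hn i j) (C a)
  have h2 := (e n).integral_sq_le_trace_mul_mse hT C a
  set V := ∫ ω, (∑ i, C a i * ((e n).T ω i - θ i)) ^ 2 ∂((e n).law (Λ θ) n)
  calc (ε / 2) ^ 2 / 8 * (C a j ^ 2 / 2)
      ≤ (ε / 2) ^ 2 / 8 * (8 * n / (ε / 2) ^ 2 * V) := by
        gcongr
        exact hBn.le.trans h1
    _ = n * V := by field_simp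
    _ ≤ _ := by gcongr

end CramerRao

end QuantumEstimation

end

theorem mainTheorem6
    {H H' : Type*}
    [NormedAddCommGroup H] [InnerProductSpace ℂ H] [CompleteSpace H]
    [TopologicalSpace.SeparableSpace H]
    [NormedAddCommGroup H'] [InnerProductSpace ℂ H'] [CompleteSpace H']
    [TopologicalSpace.SeparableSpace H']
    {m : ℕ} (Θ : Set (QuantumEstimation.Param m)) (hΘ : IsOpen Θ)
    (Λ : QuantumEstimation.Param m → QuantumEstimation.Superoperator H H')
    (hΛ : ∀ θ ∈ Θ, QuantumEstimation.IsCPTP (Λ θ))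
    (dΛ : Fin m → QuantumEstimation.Param m → QuantumEstimation.Superoperator H H')
    (ddΛ : Fin m → Fin m → QuantumEstimation.Param m → QuantumEstimation.Superoperator H H')
    (a₁ : ℝ≥0) (hreg : QuantumEstimation.RegularModel Θ Λ dΛ ddΛ a₁)
    (hint : ∃ ε > 0, ∀ u : QuantumEstimation.Param m, ‖u‖ < ε → ∀ θ ∈ Θ,
      QuantumEstimation.IsCompletelyPositive (Λ θ + ∑ i, ((u i : ℝ) : ℂ) • dΛ i θ))
    (θ : QuantumEstimation.Param m) (hθ : θ ∈ Θ)
    (G : Matrix (Fin m) (Fin m) ℝ) (hG : G.PosSemidef) (hG0 : G ≠ 0) :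
    QuantumEstimation.asymptoticCost Θ Λ dΛ a₁ G θ ≠ 0 ∧
    ∀ e : ℕ → QuantumEstimation.Estimator H H' m,
      QuantumEstimation.Admissible Θ Λ dΛ a₁ e →
      ¬ ((fun n : ℕ => (G * (e n).mse (Λ θ) θ n).trace) =O[atTop]
        fun n : ℕ => 1 / (n : ℝ) ^ 2) := by
  obtain ⟨c, hc, hle⟩ := QuantumEstimation.exists_pos_le_trace_mul_mse (a₁ := a₁) hΘ hΛ hreg.hasDeriv
    hint hθ hG hG0
  refine ⟨?_, fun e he hO => ?_⟩
  · have h : ENNReal.ofReal c ≤ QuantumEstimation.asymptoticCost Θ Λ dΛ a₁ G θ :=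
      -- The constant `c` was found before the sequence `e`, so it also bounds the infimum.
      le_iInf fun e => le_iInf fun he => le_limsup_of_frequently_le'
        ((hle e he).mono fun n hn => ENNReal.ofReal_le_ofReal hn).frequently
    exact ((ENNReal.ofReal_pos.2 hc).trans_le h).ne'
  · obtain ⟨K, hK⟩ := hO.bound
    -- Heisenberg scaling would give `n Tr G MSE ≤ K/n`, eventually below `c`.
    have hlim : Tendsto (fun n : ℕ => K / (n : ℝ)) atTop (𝓝 0) := tendsto_const_div_atTop_nhds_zero_nat K
    obtain ⟨n, h1, h2, h3, h4⟩ := ((hle e he).and (hK.and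
      ((hlim.eventually_lt_const hc).and (eventually_ge_atTop 1)))).exists
    have hn : (0 : ℝ) < n := by exact_mod_cast h4
    rw [Real.norm_eq_abs, Real.norm_of_nonneg (by positivity)] at h2
    have h5 := mul_le_mul_of_nonneg_left ((le_abs_self _).trans h2) hn.le
    have h6 : (n : ℝ) * (K * (1 / (n : ℝ) ^ 2)) = K / n := by field_simp
    linarith
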